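/- Let $m^-,m^+\ge 1$ be integers. For $m\ge1$ let $\mathcal A_+^m=\{\alpha\in\mathbb R^m:\alpha_i\ge 0 \text{ for all } i,\ \sum_{i=1}^m|\alpha_i|<1\}$, and put $\mathcal A_+=\mathcal A_+^{m^-}\times\mathcal A_+^{m^+}$. For $a,b>0$, $\boldsymbol\alpha=(\alpha^-,\alpha^+)\in\mathcal A_+$ and $\boldsymbol\eta=(\eta^-,\eta^+)\in(-1,1)^{m^-+m^+}$, let $X$ be the set of $u\in C^2[-1,1]$ (real-valued) with $$u(-1)=\sum_{i=1}^{m^-}\alpha_i^-u(\eta_i^-),\qquad u(1)=\sum_{i=1}^{m^+}\alpha_i^+u(\eta_i^+).$$ A number $\lambda\in\mathbb R$ is a half-eigenvalue with half-eigenfunction $u$ if $u\in X$ is not identically zero and $$-u''=\lambda(au^+-bu^-)\quad\text{on }(-1,1),\qquad u^\pm=\max\{\pm u,0\}.$$ For an integer $k\ge1$ and a sign $\nu\in\{+,-\}$ let $T_{k,\nu}$ be the set of $u\in X$ such that: $u'(\pm1)\neq0$ and $\nu u'(-1)>0$; $u'$ has exactly $k$ zeros in $(-1,1)$, and $u''\ne0$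 at each of them; $u$ has a zero strictly between any two consecutive zeros of $u'$ in $(-1,1)$. Then, for each $k\ge1$ and $\nu\in\{+,-\}$: for all $(a,b,\boldsymbol\alpha,\boldsymbol\eta)\in(0,\infty)^2\times\mathcal A_+\times(-1,1)^{m^-+m^+}$ there is exactly one half-eigenvalue, denoted $\lambda_{k,\nu}=\lambda_{k,\nu}(a,b,\boldsymbol\alpha,\boldsymbol\eta)$, that has a half-eigenfunction in $T_{k,\nu}$; and $\lambda_{k,\nu}$ is a $C^1$ function of $(a,b,\boldsymbol\alpha,\boldsymbol\eta)$ on the set $(0,\infty)^2\times\mathcal A_+\times(-1,1)^{m^-+m^+}$ (with derivatives taken relative to this set, that is, one-sided at points where some $\alpha_i^\pm=0$). -/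

import Mathlib

open Set

namespace MultiPoint

/-- The closed interval `[-1,1]`. -/
abbrev I : Set ℝ := Icc (-1) 1

/-- The first derivative of a function on `[-1,1]` (one-sided at the end points). -/
noncomputable def d1 (u : ℝ → ℝ) : ℝ → ℝ := derivWithin u I

/-- The second derivative of a function on `[-1,1]` (one-sided at the end points). -/
noncomputable def d2 (u : ℝ → ℝ) : ℝ → ℝ := derivWithin (d1 u) I

/-- The set `𝒜₊^m` of coefficient vectors `α ≥ 0` with `∑ |α_i| < 1`. -/
def Aplus (m : ℕ) : Set (Fin m → ℝ) := {α | (∀ i, 0 ≤ α i) ∧ ∑ i, |α i| < 1}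

/-- The space of the parameters `(a, b, (α⁻, α⁺), (η⁻, η⁺))`. -/
abbrev Params (mm mp : ℕ) : Type :=
  ℝ × ℝ × ((Fin mm → ℝ) × (Fin mp → ℝ)) × ((Fin mm → ℝ) × (Fin mp → ℝ))

namespace Params

variable {mm mp : ℕ} (P : Params mm mp)

/-- The coefficient of `u⁺`. -/
def a : ℝ := P.1
/-- The coefficient of `u⁻`. -/
def b : ℝ := P.2.1
/-- The coefficients `α⁻` of the boundary condition at `-1`. -/
def alphaM : Fin mm → ℝ := P.2.2.1.1
/-- The coefficients `α⁺` of the boundary condition at `1`. -/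
def alphaP : Fin mp → ℝ := P.2.2.1.2
/-- The points `η⁻` of the boundary condition at `-1`. -/
def etaM : Fin mm → ℝ := P.2.2.2.1
/-- The points `η⁺` of the boundary condition at `1`. -/
def etaP : Fin mp → ℝ := P.2.2.2.2

end Params

/-- The admissible parameters: `a, b > 0`, `α^± ∈ 𝒜₊^{m^±}`, `η^± ∈ (-1,1)^{m^±}`. -/
def Admissible (mm mp : ℕ) : Set (Params mm mp) :=
  {P | 0 < P.a ∧ 0 < P.b ∧ P.alphaM ∈ Aplus mm ∧ P.alphaP ∈ Aplus mp ∧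
    (∀ i, P.etaM i ∈ Ioo (-1 : ℝ) 1) ∧ (∀ i, P.etaP i ∈ Ioo (-1 : ℝ) 1)}

/-- The space `X`: the `C²` functions on `[-1,1]` that satisfy both multi-point boundary conditions.
Only the values on `[-1,1]` matter. -/
def X {mm mp : ℕ} (P : Params mm mp) : Set (ℝ → ℝ) :=
  {u | ContDiffOn ℝ 2 u I ∧
    u (-1) = ∑ i, P.alphaM i * u (P.etaM i) ∧
    u 1 = ∑ i, P.alphaP i * u (P.etaP i)}

/-- `u` is a half-eigenfunction with half-eigenvalue `lam`: a non-trivial `u ∈ X` with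
`-u'' = lam (a u⁺ - b u⁻)` on `(-1,1)`. -/
def IsHalfEigenfunction {mm mp : ℕ} (P : Params mm mp) (lam : ℝ) (u : ℝ → ℝ) : Prop :=
  u ∈ X P ∧ (∃ x ∈ I, u x ≠ 0) ∧
    ∀ x ∈ Ioo (-1 : ℝ) 1, -d2 u x = lam * (P.a * max (u x) 0 - P.b * max (-u x) 0)

/-- The nodal set `T_{k,ν} ⊆ X`; the sign `ν` is an element of `ℤˣ = {1, -1}`. -/
def T {mm mp : ℕ} (P : Params mm mp) (k : ℕ) (ν : ℤˣ) : Set (ℝ → ℝ) :=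
  {u | u ∈ X P ∧
    (d1 u (-1) ≠ 0 ∧ d1 u 1 ≠ 0 ∧ 0 < ((ν : ℤ) : ℝ) * d1 u (-1)) ∧
    ((∀ x ∈ Ioo (-1 : ℝ) 1, d1 u x = 0 → d2 u x ≠ 0) ∧
      {x | x ∈ Ioo (-1 : ℝ) 1 ∧ d1 u x = 0}.encard = (k : ℕ∞)) ∧
    (∀ x ∈ Ioo (-1 : ℝ) 1, ∀ y ∈ Ioo (-1 : ℝ) 1, x < y → d1 u x = 0 → d1 u y = 0 →
      (∀ z ∈ Ioo x y, d1 u z ≠ 0) → ∃ z ∈ Ioo x y, u z = 0)}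

/-- `lam` is a half-eigenvalue with a half-eigenfunction in `T_{k,ν}`. -/
def IsHalfEigenvalueOf {mm mp : ℕ} (k : ℕ) (ν : ℤˣ) (P : Params mm mp) (lam : ℝ) : Prop :=
  ∃ u, IsHalfEigenfunction P lam u ∧ u ∈ T P k ν

/-- `λ_{k,ν}` as a function of the parameters: the number singled out by `IsHalfEigenvalueOf`
(a meaningful definition where there is exactly one such number). -/
noncomputable def halfEigenvalue {mm mp : ℕ} (k : ℕ) (ν : ℤˣ) (P : Params mm mp) : ℝ :=
  Classical.epsilon (IsHalfEigenvalueOf k ν P)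

end MultiPoint

/-!
A half-eigenfunction has a positive half-eigenvalue `lam = s²`: otherwise `u²` would be convex, so
that `|u|` would be largest at an end point, where the boundary conditions forbid it
(`IsHalfEigenfunction.pos`). For `lam > 0` the equation is that of an autonomous half-linear
oscillator, all of whose non-trivial solutions are `u(x) = A w(θ + s (1 + x))` for one explicit
periodic function `w`, the *wave*, built from sine arcs of the frequencies `√a` and `√b`
alternately. Up to the symmetry `u ↦ -u`, `a ↔ b` one may take `u'(-1) > 0`, that is, `θ` on the
first increasing branch of `w`. Hence the half-eigenvalues of `T_{k,+}` correspond to the solutions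
`(s, θ)` of the two boundary conditions for which `θ + 2 s` lies on the `k`-th later branch
(`Shooting`, `isHalfEigenvalueOf_one_iff`).

Everything about this system follows from the conservation of energy. The point `(w, w')` moves on
the boundary of a bounded convex set that is symmetric in `w'`. If `w(t) = ∑ αᵢ w(xᵢ)` with
`αᵢ ≥ 0`, `∑ αᵢ < 1`, then for all `|cᵢ| ≤ 1` the point `(∑ αᵢ w(xᵢ), ∑ αᵢ cᵢ w'(xᵢ))` is interior
to this set and has the abscissa of the boundary point `(w(t), w'(t))`, whence
`|∑ αᵢ cᵢ w'(xᵢ)| < |w'(t)|` (`abs_sum_dwave_lt`). With `cᵢ = 1` this says that the left boundary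
condition is solved transversally in `θ`, so it selects exactly one phase `θ(s)`. With `cᵢ = ηᵢ` it
gives `θ'(s) > -1`, and so the end phase `r(s) = θ(s) + 2 s` increases; it sweeps once through each
branch after the first. On such a branch the right boundary condition changes sign from end to end,
and by the same inequality it changes sign transversally and in one direction only, hence exactly
once (`existsUnique_zero_of_crossing`, `existsUnique_shooting`).

Since `w` is jointly `C¹` in `(a, b, x)` (`contDiffAt_wave`) and both zeros are transversal, two
applications of the implicit function theorem show that `s`, hence `lam`, is a `C¹` function of the
parameters, even on a full neighbourhood of each admissible point (`exists_local_shooting`).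
-/

open Filter Topology

namespace MultiPoint

/-! ### Gluing of differentiable functions of one variable -/

theorem hasDerivAt_of_glue {f g h : ℝ → ℝ} {l p r d : ℝ} (hl : l < p) (hr : p < r)
    (hg : EqOn f g (Icc l p)) (hh : EqOn f h (Icc p r))
    (dg : HasDerivAt g d p) (dh : HasDerivAt h d p) : HasDerivAt f d p := by
  have h1 : HasDerivWithinAt f d (Iic p) p := by
    refine (dg.hasDerivWithinAt.congr_of_eventuallyEq ?_ (hg ⟨hl.le, le_rfl⟩))
    filter_upwards [Icc_mem_nhdsLE hl] with x hx using hg hx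
  have h2 : HasDerivWithinAt f d (Ici p) p := by
    refine (dh.hasDerivWithinAt.congr_of_eventuallyEq ?_ (hh ⟨le_rfl, hr.le⟩))
    filter_upwards [Icc_mem_nhdsGE hr] with x hx using hh hx
  simpa using h1.union h2

/-- The function that vanishes for `y ≤ 0` and equals `sin y - y` for `y ≥ 0`. Two sine arcs of
different frequencies with the same zero and the same slope there differ by a combination of
rescalings of this function, which is `C¹` on the whole line. -/
noncomputable def sinDefect (y : ℝ) : ℝ := Real.sin (max y 0) - max y 0

theorem hasDerivAt_sinDefect (y : ℝ) :
    HasDerivAt sinDefect (Real.cos (max y 0) - 1) y := by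
  have hR : ∀ z : ℝ, HasDerivAt (fun z => Real.sin z - z) (Real.cos z - 1) z := fun z =>
    (Real.hasDerivAt_sin z).sub (hasDerivAt_id z)
  rcases lt_trichotomy y 0 with h | h | h
  · have : sinDefect =ᶠ[𝓝 y] fun _ => (0 : ℝ) := by
      filter_upwards [Iio_mem_nhds h] with z hz
      simp [sinDefect, max_eq_right (mem_Iio.1 hz).le]
    rw [max_eq_right h.le]
    simpa using (hasDerivAt_const y (0 : ℝ)).congr_of_eventuallyEq this
  · subst h
    refine hasDerivAt_of_glue (g := fun _ => 0) (h := fun z => Real.sin z - z)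
      (l := -1) (r := 1) (by norm_num) (by norm_num) ?_ ?_ ?_ ?_
    · intro z hz; simp [sinDefect, max_eq_right hz.2]
    · intro z hz; simp [sinDefect, max_eq_left hz.1]
    · simpa using hasDerivAt_const (0 : ℝ) (0 : ℝ)
    · simpa using hR 0
  · have : sinDefect =ᶠ[𝓝 y] fun z => Real.sin z - z := by
      filter_upwards [Ioi_mem_nhds h] with z hz
      simp [sinDefect, max_eq_left (mem_Ioi.1 hz).le]
    rw [max_eq_left h.le]
    exact (hR y).congr_of_eventuallyEq this

theorem contDiff_sinDefect : ContDiff ℝ 1 sinDefect := by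
  rw [contDiff_one_iff_deriv]
  refine ⟨fun y => (hasDerivAt_sinDefect y).differentiableAt, ?_⟩
  rw [show deriv sinDefect = fun y => Real.cos (max y 0) - 1 from
    funext fun y => (hasDerivAt_sinDefect y).deriv]
  fun_prop

/-! ### The wave: the explicit solution of the half-linear oscillator -/

/-- The frequency of the `n`-th arc of the wave: even arcs are negative, odd arcs positive. -/
noncomputable def freq (a b : ℝ) (n : ℕ) : ℝ := if Even n then √b else √a

/-- The zeros of the wave; the `n`-th arc lives on `[node n, node (n + 1)]`. The start is chosen so
that the minimum of the zeroth arc is at `0`. -/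
noncomputable def node (a b : ℝ) : ℕ → ℝ
  | 0 => -(Real.pi / (2 * √b))
  | n + 1 => node a b n + Real.pi / freq a b n

/-- The turning points of the wave: the midpoints of its arcs. -/
noncomputable def turn (a b : ℝ) (n : ℕ) : ℝ := node a b n + Real.pi / (2 * freq a b n)

/-- The `n`-th arc, as a sine function on the whole line. -/
noncomputable def arc (a b : ℝ) (n : ℕ) (x : ℝ) : ℝ :=
  (-1) ^ (n + 1) * (Real.sin (freq a b n * (x - node a b n)) / freq a b n)

/-- The derivative of the `n`-th arc. -/
noncomputable def darc (a b : ℝ) (n : ℕ) (x : ℝ) : ℝ :=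
  (-1) ^ (n + 1) * Real.cos (freq a b n * (x - node a b n))

/-- The index of the arc that contains the point `x`. -/
noncomputable def arcIndex (a b x : ℝ) : ℕ := sInf {n | x < node a b (n + 1)}

/-- The wave: the solution of `-w'' = a w⁺ - b w⁻` that starts at `0` from its minimum `-1/√b`.
It is used on `[0,∞)` only. -/
noncomputable def wave (a b x : ℝ) : ℝ := arc a b (arcIndex a b x) x

/-- The derivative of the wave. -/
noncomputable def dwave (a b x : ℝ) : ℝ := darc a b (arcIndex a b x) x

section wave

variable {a b : ℝ}

theorem freq_pos (ha : 0 < a) (hb : 0 < b) (n : ℕ) : 0 < freq a b n := by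
  unfold freq; split_ifs <;> positivity

theorem node_lt_succ (ha : 0 < a) (hb : 0 < b) (n : ℕ) : node a b n < node a b (n + 1) := by
  have := freq_pos ha hb n
  have : 0 < Real.pi / freq a b n := by positivity
  simp only [node]; linarith

theorem node_strictMono (ha : 0 < a) (hb : 0 < b) : StrictMono (node a b) :=
  strictMono_nat_of_lt_succ (node_lt_succ ha hb)

theorem node_lt_turn (ha : 0 < a) (hb : 0 < b) (n : ℕ) : node a b n < turn a b n := by
  have := freq_pos ha hb n
  have : 0 < Real.pi / (2 * freq a b n) := by positivity
  simp only [turn]; linarith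

theorem turn_lt_node_succ (ha : 0 < a) (hb : 0 < b) (n : ℕ) : turn a b n < node a b (n + 1) := by
  have := freq_pos ha hb n
  have h : 0 < Real.pi / (2 * freq a b n) := by positivity
  have : Real.pi / freq a b n = 2 * (Real.pi / (2 * freq a b n)) := by field_simp
  simp only [turn, node]; linarith

theorem turn_strictMono (ha : 0 < a) (hb : 0 < b) : StrictMono (turn a b) :=
  strictMono_nat_of_lt_succ fun n =>
    (turn_lt_node_succ ha hb n).trans (node_lt_turn ha hb (n + 1))

theorem turn_zero : turn a b 0 = 0 := by
  simp [turn, node, freq]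

theorem tendsto_turn (ha : 0 < a) (hb : 0 < b) : Tendsto (turn a b) atTop atTop := by
  set M := max (√a) (√b) with hM
  have hM0 : 0 < M := lt_of_lt_of_le (Real.sqrt_pos.2 ha) (le_max_left _ _)
  have hf : ∀ n, Real.pi / M ≤ Real.pi / freq a b n := fun n => by
    apply div_le_div_of_nonneg_left Real.pi_pos.le (freq_pos ha hb n)
    unfold freq; split_ifs <;> simp [hM]
  have hn : ∀ n : ℕ, node a b 0 + n * (Real.pi / M) ≤ node a b n := by
    intro n
    induction n with
    | zero => simp
    | succ n ih =>
      simp only [node] at ih ⊢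
      push_cast
      linarith [hf n]
  refine tendsto_atTop_mono (fun n => (hn n).trans (node_lt_turn ha hb n).le) ?_
  exact tendsto_atTop_add_const_left _ _
    (tendsto_natCast_atTop_atTop.atTop_mul_const (by positivity))

theorem exists_turn_Ico (ha : 0 < a) (hb : 0 < b) {x : ℝ} (hx : 0 ≤ x) :
    ∃ n, turn a b n ≤ x ∧ x < turn a b (n + 1) := by
  classical
  have hex : ∃ n, x < turn a b n := ((tendsto_turn ha hb).eventually_gt_atTop x).exists
  have h0 : Nat.find hex ≠ 0 := by
    intro h
    have := Nat.find_spec hex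
    rw [h, turn_zero] at this
    linarith
  obtain ⟨n, hn⟩ := Nat.exists_eq_succ_of_ne_zero h0
  refine ⟨n, not_lt.1 (Nat.find_min hex (by omega)), ?_⟩
  have := Nat.find_spec hex
  rwa [hn] at this

theorem exists_node_Ico (ha : 0 < a) (hb : 0 < b) {x : ℝ} (hx : 0 ≤ x) :
    ∃ n, node a b n ≤ x ∧ x < node a b (n + 1) := by
  obtain ⟨n, h1, h2⟩ := exists_turn_Ico ha hb hx
  rcases lt_or_ge x (node a b (n + 1)) with h | h
  · exact ⟨n, (node_lt_turn ha hb n).le.trans h1, h⟩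
  · exact ⟨n + 1, h, h2.trans (turn_lt_node_succ ha hb (n + 1))⟩

theorem arcIndex_eq (ha : 0 < a) (hb : 0 < b) {n : ℕ} {x : ℝ} (h1 : node a b n ≤ x)
    (h2 : x < node a b (n + 1)) : arcIndex a b x = n := by
  apply le_antisymm
  · exact Nat.sInf_le h2
  · refine le_csInf ⟨n, h2⟩ fun m hm => ?_
    have := (node_strictMono ha hb).lt_iff_lt.1 (h1.trans_lt hm)
    omega

theorem freq_mul_node_succ_sub (ha : 0 < a) (hb : 0 < b) (n : ℕ) :
    freq a b n * (node a b (n + 1) - node a b n) = Real.pi := by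
  have := (freq_pos ha hb n).ne'
  simp only [node]; field_simp; ring

theorem freq_mul_turn_sub (ha : 0 < a) (hb : 0 < b) (n : ℕ) :
    freq a b n * (turn a b n - node a b n) = Real.pi / 2 := by
  have := (freq_pos ha hb n).ne'
  simp only [turn]; field_simp; ring

theorem arc_node_self (n : ℕ) : arc a b n (node a b n) = 0 := by simp [arc]

theorem darc_node_self (n : ℕ) : darc a b n (node a b n) = (-1) ^ (n + 1) := by simp [darc]

theorem arc_node_succ (ha : 0 < a) (hb : 0 < b) (n : ℕ) : arc a b n (node a b (n + 1)) = 0 := by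
  simp [arc, freq_mul_node_succ_sub ha hb]

theorem darc_node_succ (ha : 0 < a) (hb : 0 < b) (n : ℕ) :
    darc a b n (node a b (n + 1)) = (-1) ^ n := by
  simp [darc, freq_mul_node_succ_sub ha hb, pow_succ]

theorem wave_eq_arc (ha : 0 < a) (hb : 0 < b) {n : ℕ} {x : ℝ}
    (hx : x ∈ Icc (node a b n) (node a b (n + 1))) : wave a b x = arc a b n x := by
  rcases hx.2.lt_or_eq with h | h
  · rw [wave, arcIndex_eq ha hb hx.1 h]
  · rw [wave, h, arcIndex_eq ha hb le_rfl (node_lt_succ ha hb (n + 1)), arc_node_self,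
      arc_node_succ ha hb]

theorem dwave_eq_darc (ha : 0 < a) (hb : 0 < b) {n : ℕ} {x : ℝ}
    (hx : x ∈ Icc (node a b n) (node a b (n + 1))) : dwave a b x = darc a b n x := by
  rcases hx.2.lt_or_eq with h | h
  · rw [dwave, arcIndex_eq ha hb hx.1 h]
  · rw [dwave, h, arcIndex_eq ha hb le_rfl (node_lt_succ ha hb (n + 1)), darc_node_self,
      darc_node_succ ha hb, pow_add, pow_add]; norm_num

theorem hasDerivAt_arc (ha : 0 < a) (hb : 0 < b) (n : ℕ) (x : ℝ) :
    HasDerivAt (arc a b n) (darc a b n x) x := by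
  have hc := (freq_pos ha hb n).ne'
  have h1 : HasDerivAt (fun x => freq a b n * (x - node a b n)) (freq a b n) x := by
    simpa using ((hasDerivAt_id x).sub_const (node a b n)).const_mul (freq a b n)
  have := ((h1.sin).div_const (freq a b n)).const_mul ((-1 : ℝ) ^ (n + 1))
  refine (show HasDerivAt (arc a b n) _ x from this).congr_deriv ?_
  simp only [darc]; field_simp

theorem hasDerivAt_darc (n : ℕ) (x : ℝ) :
    HasDerivAt (darc a b n) (-(freq a b n ^ 2 * arc a b n x)) x := by
  have h1 : HasDerivAt (fun x => freq a b n * (x - node a b n)) (freq a b n) x := by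
    simpa using ((hasDerivAt_id x).sub_const (node a b n)).const_mul (freq a b n)
  have := (h1.cos).const_mul ((-1 : ℝ) ^ (n + 1))
  refine (show HasDerivAt (darc a b n) _ x from this).congr_deriv ?_
  simp only [arc]
  rcases eq_or_ne (freq a b n) 0 with h | h
  · simp [h]
  · field_simp

/-- On its own interval the `n`-th arc has the sign `(-1)^(n+1)`. -/
theorem arc_sign (ha : 0 < a) (hb : 0 < b) {n : ℕ} {x : ℝ}
    (hx : x ∈ Icc (node a b n) (node a b (n + 1))) : 0 ≤ (-1) ^ (n + 1) * arc a b n x := by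
  have hc := freq_pos ha hb n
  have h1 : 0 ≤ freq a b n * (x - node a b n) := mul_nonneg hc.le (by linarith [hx.1])
  have h2 : freq a b n * (x - node a b n) ≤ Real.pi := by
    rw [← freq_mul_node_succ_sub ha hb n]
    exact mul_le_mul_of_nonneg_left (by linarith [hx.2]) hc.le
  have := Real.sin_nonneg_of_nonneg_of_le_pi h1 h2
  rw [arc, ← mul_assoc, ← pow_add, Even.neg_one_pow ⟨n + 1, rfl⟩, one_mul]
  positivity

/-- The half-linear restoring force `a w⁺ - b w⁻`. -/
noncomputable def force (a b w : ℝ) : ℝ := a * max w 0 - b * max (-w) 0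

/-- The gauge `√a w⁺ + √b w⁻`; its square is twice the potential energy. -/
noncomputable def gauge (a b w : ℝ) : ℝ := √a * max w 0 + √b * max (-w) 0

theorem force_arc (ha : 0 < a) (hb : 0 < b) {n : ℕ} {x : ℝ}
    (hx : x ∈ Icc (node a b n) (node a b (n + 1))) :
    force a b (arc a b n x) = freq a b n ^ 2 * arc a b n x := by
  have := arc_sign ha hb hx
  rcases Nat.even_or_odd n with h | h
  · rw [h.add_one.neg_one_pow] at this
    rw [force, max_eq_right (by linarith), max_eq_left (by linarith), freq, if_pos h,
      Real.sq_sqrt hb.le]; ring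
  · rw [h.add_one.neg_one_pow] at this
    rw [force, max_eq_left (by linarith), max_eq_right (by linarith), freq,
      if_neg (Nat.not_even_iff_odd.2 h), Real.sq_sqrt ha.le]; ring

theorem gauge_arc (ha : 0 < a) (hb : 0 < b) {n : ℕ} {x : ℝ}
    (hx : x ∈ Icc (node a b n) (node a b (n + 1))) :
    gauge a b (arc a b n x) = (-1) ^ (n + 1) * (freq a b n * arc a b n x) := by
  have := arc_sign ha hb hx
  rcases Nat.even_or_odd n with h | h
  · rw [h.add_one.neg_one_pow] at this ⊢
    rw [gauge, max_eq_right (by linarith), max_eq_left (by linarith), freq, if_pos h]; ring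
  · rw [h.add_one.neg_one_pow] at this ⊢
    rw [gauge, max_eq_left (by linarith), max_eq_right (by linarith), freq,
      if_neg (Nat.not_even_iff_odd.2 h)]; ring

theorem exists_mem_arc (ha : 0 < a) (hb : 0 < b) {x : ℝ} (hx : 0 ≤ x) :
    ∃ n, x ∈ Icc (node a b n) (node a b (n + 1)) := by
  obtain ⟨n, h1, h2⟩ := exists_node_Ico ha hb hx
  exact ⟨n, h1, h2.le⟩

/-- A point of `[0,∞)` is either interior to an arc or the common end point of two arcs. -/
theorem mem_Ioo_or_eq_node (ha : 0 < a) (hb : 0 < b) {x : ℝ} (hx : 0 ≤ x) :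
    ∃ n, x ∈ Ioo (node a b n) (node a b (n + 1)) ∨ x = node a b (n + 1) := by
  obtain ⟨n, h1, h2⟩ := exists_node_Ico ha hb hx
  rcases h1.lt_or_eq with h | h
  · exact ⟨n, Or.inl ⟨h, h2⟩⟩
  · rcases n with _ | n
    · have := node_lt_turn ha hb 0
      rw [turn_zero] at this; linarith
    · exact ⟨n, Or.inr h.symm⟩

theorem hasDerivAt_wave (ha : 0 < a) (hb : 0 < b) {x : ℝ} (hx : 0 ≤ x) :
    HasDerivAt (wave a b) (dwave a b x) x := by
  obtain ⟨n, h | h⟩ := mem_Ioo_or_eq_node ha hb hx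
  · rw [dwave_eq_darc ha hb (Ioo_subset_Icc_self h)]
    refine (hasDerivAt_arc ha hb n x).congr_of_eventuallyEq ?_
    filter_upwards [Icc_mem_nhds h.1 h.2] with y hy using wave_eq_arc ha hb hy
  · have hl := node_lt_succ ha hb n
    have hr := node_lt_succ ha hb (n + 1)
    subst h
    refine hasDerivAt_of_glue hl hr (fun y hy => wave_eq_arc ha hb hy)
      (fun y hy => wave_eq_arc ha hb hy) ?_ ?_
    · rw [dwave_eq_darc ha hb ⟨hl.le, le_rfl⟩]; exact hasDerivAt_arc ha hb _ _
    · rw [dwave_eq_darc ha hb ⟨le_rfl, hr.le⟩]; exact hasDerivAt_arc ha hb _ _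

theorem hasDerivAt_dwave (ha : 0 < a) (hb : 0 < b) {x : ℝ} (hx : 0 ≤ x) :
    HasDerivAt (dwave a b) (-force a b (wave a b x)) x := by
  obtain ⟨n, h | h⟩ := mem_Ioo_or_eq_node ha hb hx
  · rw [wave_eq_arc ha hb (Ioo_subset_Icc_self h), force_arc ha hb (Ioo_subset_Icc_self h)]
    refine (hasDerivAt_darc n x).congr_of_eventuallyEq ?_
    filter_upwards [Icc_mem_nhds h.1 h.2] with y hy using dwave_eq_darc ha hb hy
  · have hl := node_lt_succ ha hb n
    have hr := node_lt_succ ha hb (n + 1)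
    subst h
    refine hasDerivAt_of_glue hl hr (fun y hy => dwave_eq_darc ha hb hy)
      (fun y hy => dwave_eq_darc ha hb hy) ?_ ?_
    · rw [wave_eq_arc ha hb ⟨hl.le, le_rfl⟩, force_arc ha hb ⟨hl.le, le_rfl⟩]
      exact hasDerivAt_darc _ _
    · rw [wave_eq_arc ha hb ⟨le_rfl, hr.le⟩, force_arc ha hb ⟨le_rfl, hr.le⟩]
      exact hasDerivAt_darc _ _

theorem wave_energy (ha : 0 < a) (hb : 0 < b) {x : ℝ} (hx : 0 ≤ x) :
    dwave a b x ^ 2 + gauge a b (wave a b x) ^ 2 = 1 := by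
  obtain ⟨n, h⟩ := exists_mem_arc ha hb hx
  have hc := (freq_pos ha hb n).ne'
  rw [dwave_eq_darc ha hb h, wave_eq_arc ha hb h, gauge_arc ha hb h, darc, arc]
  have e : ((-1 : ℝ) ^ (n + 1)) ^ 2 = 1 := by rw [← pow_mul, mul_comm]; simp
  have e2 : freq a b n * ((-1) ^ (n + 1) * (Real.sin (freq a b n * (x - node a b n)) / freq a b n))
    = (-1) ^ (n + 1) * Real.sin (freq a b n * (x - node a b n)) := by field_simp
  rw [e2, mul_pow, mul_pow, mul_pow, e, one_mul, one_mul, one_mul]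
  exact Real.cos_sq_add_sin_sq _

theorem wave_node_succ (ha : 0 < a) (hb : 0 < b) (n : ℕ) : wave a b (node a b (n + 1)) = 0 := by
  rw [wave_eq_arc ha hb ⟨(node_lt_succ ha hb n).le, le_rfl⟩, arc_node_succ ha hb]

theorem turn_mem_arc (ha : 0 < a) (hb : 0 < b) (n : ℕ) :
    turn a b n ∈ Icc (node a b n) (node a b (n + 1)) :=
  ⟨(node_lt_turn ha hb n).le, (turn_lt_node_succ ha hb n).le⟩

theorem wave_turn (ha : 0 < a) (hb : 0 < b) (n : ℕ) :
    wave a b (turn a b n) = (-1) ^ (n + 1) / freq a b n := by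
  rw [wave_eq_arc ha hb (turn_mem_arc ha hb n), arc, freq_mul_turn_sub ha hb, Real.sin_pi_div_two]
  ring

theorem dwave_turn (ha : 0 < a) (hb : 0 < b) (n : ℕ) : dwave a b (turn a b n) = 0 := by
  rw [dwave_eq_darc ha hb (turn_mem_arc ha hb n), darc, freq_mul_turn_sub ha hb,
    Real.cos_pi_div_two, mul_zero]

/-- Between consecutive turning points the wave is strictly monotone, upwards first. -/
theorem dwave_sign (ha : 0 < a) (hb : 0 < b) {n : ℕ} {x : ℝ}
    (hx : x ∈ Ioo (turn a b n) (turn a b (n + 1))) : 0 < (-1) ^ n * dwave a b x := by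
  have e : ∀ m : ℕ, (-1 : ℝ) ^ m * (-1) ^ m = 1 := fun m => by
    rw [← pow_add, Even.neg_one_pow ⟨m, rfl⟩]
  rcases le_or_gt x (node a b (n + 1)) with h | h
  · have hc := freq_pos ha hb n
    have h1 : Real.pi / 2 < freq a b n * (x - node a b n) := by
      rw [← freq_mul_turn_sub ha hb n]
      exact mul_lt_mul_of_pos_left (by linarith [hx.1]) hc
    have h2 : freq a b n * (x - node a b n) ≤ Real.pi := by
      rw [← freq_mul_node_succ_sub ha hb n]
      exact mul_le_mul_of_nonneg_left (by linarith) hc.le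
    have := Real.cos_neg_of_pi_div_two_lt_of_lt h1 (by linarith [Real.pi_pos])
    rw [dwave_eq_darc ha hb ⟨(node_lt_turn ha hb n).le.trans hx.1.le, h⟩, darc, pow_succ,
      show (-1 : ℝ) ^ n * ((-1) ^ n * -1 * Real.cos (freq a b n * (x - node a b n))) =
        ((-1 : ℝ) ^ n * (-1) ^ n) * -Real.cos (freq a b n * (x - node a b n)) by ring, e]
    linarith
  · have hc := freq_pos ha hb (n + 1)
    have h1 : 0 < freq a b (n + 1) * (x - node a b (n + 1)) := mul_pos hc (by linarith)
    have h2 : freq a b (n + 1) * (x - node a b (n + 1)) < Real.pi / 2 := by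
      rw [← freq_mul_turn_sub ha hb (n + 1)]
      exact mul_lt_mul_of_pos_left (by linarith [hx.2]) hc
    have := Real.cos_pos_of_mem_Ioo ⟨by linarith [Real.pi_pos], h2⟩
    rw [dwave_eq_darc ha hb ⟨h.le, hx.2.le.trans (turn_lt_node_succ ha hb (n + 1)).le⟩, darc,
      pow_add, pow_add, show (-1 : ℝ) ^ n * ((-1) ^ n * (-1) ^ 1 * (-1) ^ 1 *
        Real.cos (freq a b (n + 1) * (x - node a b (n + 1)))) =
        ((-1 : ℝ) ^ n * (-1) ^ n) * Real.cos (freq a b (n + 1) * (x - node a b (n + 1))) by ring, e]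
    linarith

theorem dwave_eq_zero_iff (ha : 0 < a) (hb : 0 < b) {x : ℝ} (hx : 0 ≤ x) :
    dwave a b x = 0 ↔ ∃ n, x = turn a b n := by
  constructor
  · intro h
    obtain ⟨n, h1, h2⟩ := exists_turn_Ico ha hb hx
    rcases h1.lt_or_eq with h3 | h3
    · have := dwave_sign ha hb ⟨h3, h2⟩
      simp [h] at this
    · exact ⟨n, h3.symm⟩
  · rintro ⟨n, rfl⟩
    exact dwave_turn ha hb n

/-! ### Joint smoothness of the wave -/

theorem contDiffAt_freq (ha : 0 < a) (hb : 0 < b) (n : ℕ) :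
    ContDiffAt ℝ 1 (fun q : ℝ × ℝ => freq q.1 q.2 n) (a, b) := by
  unfold freq
  split_ifs
  · exact contDiffAt_snd.sqrt hb.ne'
  · exact contDiffAt_fst.sqrt ha.ne'

theorem contDiffAt_node (ha : 0 < a) (hb : 0 < b) (n : ℕ) :
    ContDiffAt ℝ 1 (fun q : ℝ × ℝ => node q.1 q.2 n) (a, b) := by
  induction n with
  | zero =>
    simp only [node]
    have : (2 * √b) ≠ 0 := by positivity
    exact (contDiffAt_const.div (contDiffAt_const.mul (contDiffAt_snd.sqrt hb.ne')) this).neg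
  | succ n ih =>
    simp only [node]
    exact ih.add (contDiffAt_const.div (contDiffAt_freq ha hb n) (freq_pos ha hb n).ne')

theorem contDiffAt_turn (ha : 0 < a) (hb : 0 < b) (n : ℕ) :
    ContDiffAt ℝ 1 (fun q : ℝ × ℝ => turn q.1 q.2 n) (a, b) := by
  simp only [turn]
  have := freq_pos ha hb n
  exact (contDiffAt_node ha hb n).add (contDiffAt_const.div
    (contDiffAt_const.mul (contDiffAt_freq ha hb n)) (by positivity))

/-- The correction that turns each arc into the next one. It does not depend on the arc. -/
noncomputable def arcJump (a b y : ℝ) : ℝ := sinDefect (√a * y) / √a - sinDefect (√b * y) / √b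

theorem arcJump_of_nonpos {y : ℝ} (hy : y ≤ 0) : arcJump a b y = 0 := by
  have h1 : √a * y ≤ 0 := mul_nonpos_of_nonneg_of_nonpos (Real.sqrt_nonneg a) hy
  have h2 : √b * y ≤ 0 := mul_nonpos_of_nonneg_of_nonpos (Real.sqrt_nonneg b) hy
  simp [arcJump, sinDefect, h1, h2]

theorem arcJump_of_nonneg (ha : 0 < a) (hb : 0 < b) {y : ℝ} (hy : 0 ≤ y) :
    arcJump a b y = Real.sin (√a * y) / √a - Real.sin (√b * y) / √b := by
  have h1 : 0 ≤ √a * y := mul_nonneg (Real.sqrt_nonneg a) hy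
  have h2 : 0 ≤ √b * y := mul_nonneg (Real.sqrt_nonneg b) hy
  have := (Real.sqrt_pos.2 ha).ne'
  have := (Real.sqrt_pos.2 hb).ne'
  rw [arcJump, sinDefect, sinDefect, max_eq_left h1, max_eq_left h2]
  field_simp
  ring

theorem arc_succ_eq (ha : 0 < a) (hb : 0 < b) (n : ℕ) {x : ℝ} (hx : node a b (n + 1) ≤ x) :
    arc a b (n + 1) x = arc a b n x + arcJump a b (x - node a b (n + 1)) := by
  have hs : Real.sin (freq a b n * (x - node a b n)) =
      -Real.sin (freq a b n * (x - node a b (n + 1))) := by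
    rw [← Real.sin_add_pi, ← freq_mul_node_succ_sub ha hb n]
    congr 1; ring
  rw [arcJump_of_nonneg ha hb (by linarith), arc, arc, hs]
  rcases Nat.even_or_odd n with h | h
  · rw [h.add_one.neg_one_pow, h.add_one.add_one.neg_one_pow, freq, freq, if_pos h,
      if_neg (Nat.not_even_iff_odd.2 h.add_one)]
    ring
  · rw [h.add_one.neg_one_pow, h.add_one.add_one.neg_one_pow, freq, freq,
      if_neg (Nat.not_even_iff_odd.2 h), if_pos h.add_one]
    ring

theorem wave_eq_arc_add_arcJump (ha : 0 < a) (hb : 0 < b) {n : ℕ} {x : ℝ}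
    (h1 : node a b n ≤ x) (h2 : x ≤ node a b (n + 2)) :
    wave a b x = arc a b n x + arcJump a b (x - node a b (n + 1)) := by
  rcases le_total x (node a b (n + 1)) with h | h
  · rw [wave_eq_arc ha hb ⟨h1, h⟩, arcJump_of_nonpos (by linarith), add_zero]
  · rw [wave_eq_arc ha hb ⟨h, h2⟩, arc_succ_eq ha hb n h]

/-- The wave is jointly `C¹` in the coefficients and the point: near each point it is one sine arc
plus an `arcJump`, also where it passes from one arc to the next. -/
theorem contDiffAt_wave (ha : 0 < a) (hb : 0 < b) {x : ℝ} (hx : 0 ≤ x) :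
    ContDiffAt ℝ 1 (fun q : ℝ × ℝ × ℝ => wave q.1 q.2.1 q.2.2) (a, b, x) := by
  obtain ⟨n, h1, h2⟩ : ∃ n, node a b n < x ∧ x < node a b (n + 2) := by
    obtain ⟨n, h | h⟩ := mem_Ioo_or_eq_node ha hb hx
    · exact ⟨n, h.1, h.2.trans (node_lt_succ ha hb (n + 1))⟩
    · exact ⟨n, h ▸ node_lt_succ ha hb n, h ▸ node_lt_succ ha hb (n + 1)⟩
  have hab : ContDiffAt ℝ 1 (fun q : ℝ × ℝ × ℝ => (q.1, q.2.1)) (a, b, x) := by fun_prop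
  have hnode : ∀ m, ContDiffAt ℝ 1 (fun q : ℝ × ℝ × ℝ => node q.1 q.2.1 m) (a, b, x) := fun m =>
    ContDiffAt.comp (a, b, x) (g := fun q : ℝ × ℝ => node q.1 q.2 m)
      (f := fun q : ℝ × ℝ × ℝ => (q.1, q.2.1)) (contDiffAt_node ha hb m) hab
  have hfreq : ContDiffAt ℝ 1 (fun q : ℝ × ℝ × ℝ => freq q.1 q.2.1 n) (a, b, x) :=
    ContDiffAt.comp (a, b, x) (g := fun q : ℝ × ℝ => freq q.1 q.2 n)
      (f := fun q : ℝ × ℝ × ℝ => (q.1, q.2.1)) (contDiffAt_freq ha hb n) hab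
  have hx' : ContDiffAt ℝ 1 (fun q : ℝ × ℝ × ℝ => q.2.2) (a, b, x) := by fun_prop
  have hsa : ContDiffAt ℝ 1 (fun q : ℝ × ℝ × ℝ => √q.1) (a, b, x) :=
    contDiffAt_fst.sqrt ha.ne'
  have hsb : ContDiffAt ℝ 1 (fun q : ℝ × ℝ × ℝ => √q.2.1) (a, b, x) :=
    ContDiffAt.sqrt (by fun_prop) hb.ne'
  have hy := hx'.sub (hnode (n + 1))
  have key : ContDiffAt ℝ 1 (fun q : ℝ × ℝ × ℝ => arc q.1 q.2.1 n q.2.2 +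
      arcJump q.1 q.2.1 (q.2.2 - node q.1 q.2.1 (n + 1))) (a, b, x) := by
    unfold arc arcJump
    refine (contDiffAt_const.mul (((hfreq.mul (hx'.sub (hnode n))).sin).div hfreq
      (freq_pos ha hb n).ne')).add (ContDiffAt.sub ?_ ?_)
    · exact ((contDiff_sinDefect.contDiffAt).comp _ (hsa.mul hy)).div hsa (Real.sqrt_pos.2 ha).ne'
    · exact ((contDiff_sinDefect.contDiffAt).comp _ (hsb.mul hy)).div hsb (Real.sqrt_pos.2 hb).ne'
  refine key.congr_of_eventuallyEq ?_
  have e1 : ∀ᶠ q : ℝ × ℝ × ℝ in 𝓝 (a, b, x), 0 < q.1 :=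
    continuousAt_fst.eventually_const_lt ha
  have e2 : ∀ᶠ q : ℝ × ℝ × ℝ in 𝓝 (a, b, x), 0 < q.2.1 :=
    (show ContinuousAt (fun q : ℝ × ℝ × ℝ => q.2.1) (a, b, x) by fun_prop).eventually_const_lt hb
  have e3 := ContinuousAt.eventually_lt (hnode n).continuousAt hx'.continuousAt h1
  have e4 := ContinuousAt.eventually_lt hx'.continuousAt (hnode (n + 2)).continuousAt h2
  filter_upwards [e1, e2, e3, e4] with q h1 h2 h3 h4
  exact wave_eq_arc_add_arcJump h1 h2 h3.le h4.le

end wave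

/-! ### Two calculus lemmas: transversal zeros and implicit functions -/

/-- A function that is negative on the left, positive on the right, and has a positive derivative
at each of its zeros has exactly one zero. -/
theorem existsUnique_zero_of_crossing {f f' : ℝ → ℝ} {l r : ℝ} (hlr : l < r)
    (hf : ContinuousOn f (Icc l r)) (hl : f l < 0) (hr : 0 < f r)
    (hd : ∀ x ∈ Ioo l r, HasDerivAt f (f' x) x) (hpos : ∀ x ∈ Ioo l r, f x = 0 → 0 < f' x) :
    ∃! x, x ∈ Ioo l r ∧ f x = 0 := by
  have hnot : ∀ x ∈ Ioo l r, f x = 0 → ∀ y ∈ Ioo l r, f y = 0 → ¬ x < y := by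
    intro x hx hfx y hy hfy hxy
    have hsub : ∀ z ∈ Icc x y, z ∈ Ioo l r := fun z hz =>
      ⟨hx.1.trans_le hz.1, hz.2.trans_lt hy.2⟩
    have h1 : ∀ z ∈ Icc x y, (0 : ℝ) ≤ f z := by
      intro z hz
      refine image_le_of_deriv_right_lt_deriv_boundary' (f := fun _ => 0) (f' := fun _ => 0)
        (B := f) (B' := f') continuousOn_const (fun _ _ => hasDerivWithinAt_const _ _ _)
        hfx.ge (hf.mono fun w hw => Ioo_subset_Icc_self (hsub w hw))
        (fun w hw => (hd w (hsub w ⟨hw.1, hw.2.le⟩)).hasDerivWithinAt)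
        (fun w hw h => hpos w (hsub w ⟨hw.1, hw.2.le⟩) h.symm) hz
    -- just to the left of `y` the function is negative
    have h2 : ∀ᶠ z in 𝓝[<] y, f z < f y := by
      have hs := hasDerivAt_iff_tendsto_slope_left_right.1 (hd y hy) |>.1
      have := hs.eventually_const_lt (hpos y hy hfy)
      filter_upwards [this, self_mem_nhdsWithin] with z hz hzy
      rw [slope_def_field] at hz
      by_contra hcon
      have h3 : f z - f y ≥ 0 := by linarith
      have h4 : z - y < 0 := by linarith [mem_Iio.1 hzy]
      linarith [div_nonpos_of_nonneg_of_nonpos h3 h4.le]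
    have h3 : ∀ᶠ z in 𝓝[<] y, z ∈ Icc x y := by
      filter_upwards [Ioo_mem_nhdsLT hxy] with z hz using Ioo_subset_Icc_self hz
    obtain ⟨z, hz1, hz2⟩ := (h2.and h3).exists
    linarith [h1 z hz2]
  obtain ⟨x, hx, hfx⟩ := intermediate_value_Ioo hlr.le hf ⟨hl, hr⟩
  refine ⟨x, ⟨hx, hfx⟩, ?_⟩
  rintro y ⟨hy, hfy⟩
  rcases lt_trichotomy x y with h | h | h
  · exact absurd h (hnot x hx hfx y hy hfy)
  · exact h.symm
  · exact absurd h (hnot y hy hfy x hx hfx)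

/-- The implicit function theorem for one real unknown, in the form in which it is used. -/
theorem exists_implicit_real {E : Type*} [NormedAddCommGroup E] [NormedSpace ℝ E] [CompleteSpace E]
    {F : E × ℝ → ℝ} {p₀ : E} {t₀ d : ℝ} (hF : ContDiffAt ℝ 1 F (p₀, t₀)) (h0 : F (p₀, t₀) = 0)
    (hd : HasDerivAt (fun t => F (p₀, t)) d t₀) (hd0 : d ≠ 0) :
    ∃ g : E → ℝ, ContDiffAt ℝ 1 g p₀ ∧ g p₀ = t₀ ∧ ∀ᶠ p in 𝓝 p₀, F (p, g p) = 0 := by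
  have hfd : HasFDerivAt F (fderiv ℝ F (p₀, t₀)) (p₀, t₀) :=
    (hF.differentiableAt one_ne_zero).hasFDerivAt
  have h1 : HasFDerivAt (fun t : ℝ => F (p₀, t))
      (fderiv ℝ F (p₀, t₀) ∘L .inr ℝ E ℝ) t₀ :=
    HasFDerivAt.comp (g := F) (f := fun t : ℝ => (p₀, t)) t₀ hfd (hasFDerivAt_prodMk_right p₀ t₀)
  have hinv : (fderiv ℝ F (p₀, t₀) ∘L .inr ℝ E ℝ).IsInvertible := by
    refine ⟨ContinuousLinearEquiv.unitsEquivAut ℝ (Units.mk0 d hd0), ?_⟩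
    rw [h1.unique hd.hasFDerivAt]
    ext
    simp
  have hself := hF.implicitFunction_apply_self one_ne_zero hinv
  have hev := hF.eventually_apply_implicitFunction one_ne_zero hinv
  rw [h0] at hev
  exact ⟨hF.implicitFunction one_ne_zero hinv, hF.contDiffAt_implicitFunction one_ne_zero hinv,
    hself, hev⟩

/-! ### Consequences of the conservation of energy -/

section energy

variable {a b : ℝ}

theorem gauge_eq_max (w : ℝ) : gauge a b w = max (√a * w) (-(√b * w)) := by
  have ha := Real.sqrt_nonneg a
  have hb := Real.sqrt_nonneg b
  rcases le_total 0 w with h | h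
  · rw [gauge, max_eq_left h, max_eq_right (by linarith), max_eq_left]
    · ring
    · nlinarith
  · rw [gauge, max_eq_right h, max_eq_left (by linarith), max_eq_right]
    · ring
    · nlinarith

theorem gauge_nonneg (w : ℝ) : 0 ≤ gauge a b w := by
  have ha := Real.sqrt_nonneg a
  have hb := Real.sqrt_nonneg b
  unfold gauge
  have := le_max_right w 0
  have := le_max_right (-w) 0
  positivity

theorem gauge_sum_le {ι : Type*} (s : Finset ι) (α w : ι → ℝ) (hα : ∀ i, 0 ≤ α i) :
    gauge a b (∑ i ∈ s, α i * w i) ≤ ∑ i ∈ s, α i * gauge a b (w i) := by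
  rw [gauge_eq_max]
  refine max_le ?_ ?_
  · rw [Finset.mul_sum]
    refine Finset.sum_le_sum fun i _ => ?_
    rw [gauge_eq_max, mul_left_comm]
    exact mul_le_mul_of_nonneg_left (le_max_left _ _) (hα i)
  · rw [Finset.mul_sum, ← Finset.sum_neg_distrib]
    refine Finset.sum_le_sum fun i _ => ?_
    rw [gauge_eq_max, mul_left_comm, ← mul_neg]
    exact mul_le_mul_of_nonneg_left (le_max_right _ _) (hα i)

variable {ι : Type*} [Fintype ι] {α c x : ι → ℝ} {t : ℝ}

/-- The points `(w, w')` of the wave run on the boundary of the convex set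
`v² + gauge(w)² ≤ 1`, which is symmetric in `v`. A subconvex combination of points of this set is
interior to it, so if it has the abscissa of a boundary point then its ordinate is smaller in
absolute value. -/
theorem abs_sum_dwave_lt (ha : 0 < a) (hb : 0 < b) (hα : ∀ i, 0 ≤ α i) (hs : ∑ i, α i < 1)
    (hc : ∀ i, |c i| ≤ 1) (hx : ∀ i, 0 ≤ x i) (ht : 0 ≤ t)
    (h : wave a b t = ∑ i, α i * wave a b (x i)) :
    |∑ i, α i * (c i * dwave a b (x i))| < |dwave a b t| := by
  set S := ∑ i, α i with hS
  have hS0 : 0 ≤ S := Finset.sum_nonneg fun i _ => hα i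
  set g : ι → ℝ := fun i => gauge a b (wave a b (x i))
  set v : ι → ℝ := fun i => c i * dwave a b (x i)
  have hgv : ∀ i, v i ^ 2 + g i ^ 2 ≤ 1 := fun i => by
    have h1 := wave_energy ha hb (hx i)
    have h2 : c i ^ 2 ≤ 1 := (sq_le_one_iff_abs_le_one _).2 (hc i)
    have h3 := sq_nonneg (dwave a b (x i))
    simp only [v, g, mul_pow]
    nlinarith
  have cs : ∀ z : ι → ℝ, (∑ i, α i * z i) ^ 2 ≤ S * ∑ i, α i * z i ^ 2 := fun z =>
    Finset.sum_sq_le_sum_mul_sum_of_sq_le_mul _ (fun i _ => hα i)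
      (fun i _ => mul_nonneg (hα i) (sq_nonneg _)) (fun i _ => le_of_eq (by ring))
  have h1 : gauge a b (wave a b t) ≤ ∑ i, α i * g i := h ▸ gauge_sum_le _ _ _ hα
  have h2 : gauge a b (wave a b t) ^ 2 ≤ (∑ i, α i * g i) ^ 2 :=
    pow_le_pow_left₀ (gauge_nonneg _) h1 2
  have h3 : ∑ i, α i * v i ^ 2 + ∑ i, α i * g i ^ 2 ≤ S := by
    rw [← Finset.sum_add_distrib, hS]
    refine Finset.sum_le_sum fun i _ => ?_
    rw [← mul_add]
    exact mul_le_of_le_one_right (hα i) (hgv i)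
  have h4 := cs v
  have h5 := cs g
  have h6 := wave_energy ha hb ht
  apply sq_lt_sq.1
  have h7 : S * ∑ i, α i * v i ^ 2 + S * ∑ i, α i * g i ^ 2 ≤ S * S := by
    rw [← mul_add]; exact mul_le_mul_of_nonneg_left h3 hS0
  have h8 : S * S < 1 := by nlinarith
  change (∑ i, α i * v i) ^ 2 < _
  linarith

theorem gauge_wave_le_one (ha : 0 < a) (hb : 0 < b) (ht : 0 ≤ t) :
    gauge a b (wave a b t) ≤ 1 := by
  have h1 := wave_energy ha hb ht
  have h2 := sq_nonneg (dwave a b t)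
  have h3 := gauge_nonneg (a := a) (b := b) (wave a b t)
  nlinarith

/-- A subconvex combination of values of the wave stays below its extreme value at a turning
point. -/
theorem wave_turn_extreme (ha : 0 < a) (hb : 0 < b) (hα : ∀ i, 0 ≤ α i) (hs : ∑ i, α i < 1)
    (hx : ∀ i, 0 ≤ x i) (n : ℕ) :
    (-1) ^ n * (wave a b (turn a b n) - ∑ i, α i * wave a b (x i)) < 0 := by
  have hg : gauge a b (∑ i, α i * wave a b (x i)) < 1 := by
    refine (gauge_sum_le _ _ _ hα).trans_lt (lt_of_le_of_lt ?_ hs)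
    exact Finset.sum_le_sum fun i _ =>
      mul_le_of_le_one_right (hα i) (gauge_wave_le_one ha hb (hx i))
  rw [gauge_eq_max, max_lt_iff] at hg
  rw [wave_turn ha hb]
  have hA := Real.sqrt_pos.2 ha
  have hB := Real.sqrt_pos.2 hb
  rcases Nat.even_or_odd n with h | h
  · rw [h.neg_one_pow, h.add_one.neg_one_pow, freq, if_pos h]
    have : -1 / √b < ∑ i, α i * wave a b (x i) := by
      rw [div_lt_iff₀ hB]; linarith [hg.2]
    linarith
  · rw [h.neg_one_pow, h.add_one.neg_one_pow, freq, if_neg (Nat.not_even_iff_odd.2 h)]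
    have : ∑ i, α i * wave a b (x i) < 1 / √a := by
      rw [lt_div_iff₀ hA]; linarith [hg.1]
    linarith

end energy

/-! ### The shooting system -/

section defect

variable {mm mp : ℕ}

/-- The defect in the boundary condition at `-1` of the function `x ↦ wave (θ + s (x + 1))`. -/
noncomputable def leftDefect (P : Params mm mp) (s θ : ℝ) : ℝ :=
  wave P.a P.b θ - ∑ i, P.alphaM i * wave P.a P.b (θ + s * (1 + P.etaM i))

/-- The defect in the boundary condition at `1` of the function `x ↦ wave (θ + s (x + 1))`. -/
noncomputable def rightDefect (P : Params mm mp) (s θ : ℝ) : ℝ :=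
  wave P.a P.b (θ + 2 * s) - ∑ i, P.alphaP i * wave P.a P.b (θ + s * (1 + P.etaP i))

/-- The shooting system for the phase `θ` and the speed `s = √λ`: both boundary conditions hold,
the phase is on the first increasing branch of the wave, and exactly `k` turning points lie
between the phases at `-1` and at `1`. -/
def Shooting (P : Params mm mp) (k : ℕ) (s θ : ℝ) : Prop :=
  0 < s ∧ θ ∈ Ioo 0 (turn P.a P.b 1) ∧
    θ + 2 * s ∈ Ioo (turn P.a P.b k) (turn P.a P.b (k + 1)) ∧
    leftDefect P s θ = 0 ∧ rightDefect P s θ = 0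

variable {P : Params mm mp} {s θ : ℝ}

theorem sum_lt_one_of_mem_Aplus {m : ℕ} {α : Fin m → ℝ} (h : α ∈ Aplus m) : ∑ i, α i < 1 := by
  have := h.2
  rwa [Finset.sum_congr rfl fun i _ => abs_of_nonneg (h.1 i)] at this

theorem add_mul_nonneg {θ s η : ℝ} (hθ : 0 ≤ θ) (hs : 0 ≤ s) (hη : η ∈ Ioo (-1 : ℝ) 1) :
    0 ≤ θ + s * (1 + η) := add_nonneg hθ (mul_nonneg hs (by linarith [hη.1]))

theorem abs_le_one_of_mem {η : ℝ} (hη : η ∈ Ioo (-1 : ℝ) 1) : |η| ≤ 1 :=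
  abs_le.2 ⟨hη.1.le, hη.2.le⟩

theorem dwave_pos {a b : ℝ} (ha : 0 < a) (hb : 0 < b) {x : ℝ} (hx : x ∈ Ioo 0 (turn a b 1)) :
    0 < dwave a b x := by
  have h := dwave_sign ha hb (n := 0) (x := x) (by rw [turn_zero]; exact hx)
  simpa using h

theorem hasDerivAt_defect {a b : ℝ} (ha : 0 < a) (hb : 0 < b) {ι : Type*} [Fintype ι] {α : ι → ℝ}
    {p : ℝ → ℝ} {y : ι → ℝ → ℝ} {p' z : ℝ} {y' : ι → ℝ} (hp : HasDerivAt p p' z)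
    (hy : ∀ i, HasDerivAt (y i) (y' i) z) (hp0 : 0 ≤ p z) (hy0 : ∀ i, 0 ≤ y i z) :
    HasDerivAt (fun z => wave a b (p z) - ∑ i, α i * wave a b (y i z))
      (p' * dwave a b (p z) - ∑ i, α i * (y' i * dwave a b (y i z))) z := by
  refine HasDerivAt.sub ?_ (HasDerivAt.fun_sum fun i _ => HasDerivAt.const_mul _ ?_)
  · rw [mul_comm]; exact (hasDerivAt_wave ha hb hp0).comp z hp
  · rw [mul_comm]; exact (hasDerivAt_wave ha hb (hy0 i)).comp z (hy i)

theorem hasDerivAt_leftDefect (hP : P ∈ Admissible mm mp) (hs : 0 ≤ s) (hθ : 0 ≤ θ) :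
    HasDerivAt (leftDefect P s) (dwave P.a P.b θ -
      ∑ i, P.alphaM i * (1 * dwave P.a P.b (θ + s * (1 + P.etaM i)))) θ := by
  obtain ⟨ha, hb, -, -, hη, -⟩ := hP
  have h := hasDerivAt_defect ha hb (α := P.alphaM) (y := fun i θ => θ + s * (1 + P.etaM i))
    (hasDerivAt_id θ) (y' := fun _ => 1) (fun i => (hasDerivAt_id θ).add_const _) hθ
    (fun i => add_mul_nonneg hθ hs (hη i))
  exact h.congr_deriv (by simp)

/-- At a zero of the left defect on the first increasing branch, the defect increases with the
phase. -/
theorem deriv_leftDefect_pos (hP : P ∈ Admissible mm mp) (hs : 0 ≤ s)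
    (hθ : θ ∈ Ioo 0 (turn P.a P.b 1)) (h : leftDefect P s θ = 0) :
    0 < dwave P.a P.b θ -
      ∑ i, P.alphaM i * (1 * dwave P.a P.b (θ + s * (1 + P.etaM i))) := by
  obtain ⟨ha, hb, hα, -, hη, -⟩ := hP
  have h1 := abs_sum_dwave_lt ha hb hα.1 (sum_lt_one_of_mem_Aplus hα) (c := fun _ => 1)
    (by simp) (fun i => add_mul_nonneg hθ.1.le hs (hη i)) hθ.1.le (sub_eq_zero.1 h)
  rw [abs_of_pos (dwave_pos ha hb hθ)] at h1
  linarith [le_abs_self (∑ i, P.alphaM i * (1 * dwave P.a P.b (θ + s * (1 + P.etaM i))))]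

theorem leftDefect_zero_neg (hP : P ∈ Admissible mm mp) (hs : 0 ≤ s) : leftDefect P s 0 < 0 := by
  obtain ⟨ha, hb, hα, -, hη, -⟩ := hP
  have := wave_turn_extreme ha hb hα.1 (sum_lt_one_of_mem_Aplus hα)
    (fun i => add_mul_nonneg le_rfl hs (hη i)) 0
  rw [turn_zero] at this
  simpa [leftDefect] using this

theorem existsUnique_leftPhase (hP : P ∈ Admissible mm mp) (hs : 0 ≤ s) :
    ∃! θ, θ ∈ Ioo 0 (turn P.a P.b 1) ∧ leftDefect P s θ = 0 := by
  have hP' := hP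
  obtain ⟨ha, hb, hα, -, hη, -⟩ := hP'
  have h1 : 0 < turn P.a P.b 1 := by
    have := turn_strictMono ha hb zero_lt_one
    rwa [turn_zero] at this
  refine existsUnique_zero_of_crossing h1
    (fun x hx => (hasDerivAt_leftDefect hP hs hx.1).continuousAt.continuousWithinAt)
    (leftDefect_zero_neg hP hs) ?_ (fun x hx => hasDerivAt_leftDefect hP hs hx.1.le)
    (fun x hx h => deriv_leftDefect_pos hP hs hx h)
  have := wave_turn_extreme ha hb hα.1 (sum_lt_one_of_mem_Aplus hα)
    (fun i => add_mul_nonneg h1.le hs (hη i)) 1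
  simpa [leftDefect] using this

/-! ### Smooth dependence of the defects on all variables -/

theorem contDiffAt_wave_comp {E : Type*} [NormedAddCommGroup E] [NormedSpace ℝ E]
    {f g h : E → ℝ} {e : E} (hf : ContDiffAt ℝ 1 f e) (hg : ContDiffAt ℝ 1 g e)
    (hh : ContDiffAt ℝ 1 h e) (hf0 : 0 < f e) (hg0 : 0 < g e) (hh0 : 0 ≤ h e) :
    ContDiffAt ℝ 1 (fun e => wave (f e) (g e) (h e)) e :=
  ContDiffAt.comp e (g := fun q : ℝ × ℝ × ℝ => wave q.1 q.2.1 q.2.2)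
    (f := fun e => (f e, g e, h e)) (contDiffAt_wave hf0 hg0 hh0) (hf.prodMk (hg.prodMk hh))

theorem contDiff_params_a : ContDiff ℝ 1 (fun P : Params mm mp => P.a) := by
  unfold Params.a; fun_prop

theorem contDiff_params_b : ContDiff ℝ 1 (fun P : Params mm mp => P.b) := by
  unfold Params.b; fun_prop

theorem contDiff_params_alphaM (i : Fin mm) :
    ContDiff ℝ 1 (fun P : Params mm mp => P.alphaM i) := by
  unfold Params.alphaM; fun_prop

theorem contDiff_params_alphaP (i : Fin mp) :
    ContDiff ℝ 1 (fun P : Params mm mp => P.alphaP i) := by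
  unfold Params.alphaP; fun_prop

theorem contDiff_params_etaM (i : Fin mm) :
    ContDiff ℝ 1 (fun P : Params mm mp => P.etaM i) := by
  unfold Params.etaM; fun_prop

theorem contDiff_params_etaP (i : Fin mp) :
    ContDiff ℝ 1 (fun P : Params mm mp => P.etaP i) := by
  unfold Params.etaP; fun_prop

theorem contDiffAt_leftDefect {E : Type*} [NormedAddCommGroup E] [NormedSpace ℝ E]
    {p : E → Params mm mp} {σ φ : E → ℝ} {e : E} (hp : ContDiffAt ℝ 1 p e)
    (hσ : ContDiffAt ℝ 1 σ e) (hφ : ContDiffAt ℝ 1 φ e) (hP : p e ∈ Admissible mm mp)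
    (hs : 0 ≤ σ e) (hθ : 0 ≤ φ e) :
    ContDiffAt ℝ 1 (fun e => leftDefect (p e) (σ e) (φ e)) e := by
  obtain ⟨ha, hb, -, -, hη, -⟩ := hP
  have hpa := (contDiff_params_a.contDiffAt (x := p e)).comp e hp
  have hpb := (contDiff_params_b.contDiffAt (x := p e)).comp e hp
  refine (contDiffAt_wave_comp hpa hpb hφ ha hb hθ).sub (ContDiffAt.sum fun i _ =>
    ((contDiff_params_alphaM i).contDiffAt.comp e hp).mul
      (contDiffAt_wave_comp hpa hpb ?_ ha hb (add_mul_nonneg hθ hs (hη i))))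
  exact hφ.add (hσ.mul (contDiffAt_const.add ((contDiff_params_etaM i).contDiffAt.comp e hp)))

theorem contDiffAt_rightDefect {E : Type*} [NormedAddCommGroup E] [NormedSpace ℝ E]
    {p : E → Params mm mp} {σ φ : E → ℝ} {e : E} (hp : ContDiffAt ℝ 1 p e)
    (hσ : ContDiffAt ℝ 1 σ e) (hφ : ContDiffAt ℝ 1 φ e) (hP : p e ∈ Admissible mm mp)
    (hs : 0 ≤ σ e) (hθ : 0 ≤ φ e) :
    ContDiffAt ℝ 1 (fun e => rightDefect (p e) (σ e) (φ e)) e := by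
  obtain ⟨ha, hb, -, -, -, hη⟩ := hP
  have hpa := (contDiff_params_a.contDiffAt (x := p e)).comp e hp
  have hpb := (contDiff_params_b.contDiffAt (x := p e)).comp e hp
  refine (contDiffAt_wave_comp hpa hpb (hφ.add (contDiffAt_const.mul hσ)) ha hb
    (by positivity)).sub (ContDiffAt.sum fun i _ =>
    ((contDiff_params_alphaP i).contDiffAt.comp e hp).mul
      (contDiffAt_wave_comp hpa hpb ?_ ha hb (add_mul_nonneg hθ hs (hη i))))
  exact hφ.add (hσ.mul (contDiffAt_const.add ((contDiff_params_etaP i).contDiffAt.comp e hp)))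

/-! ### The phase selected by the left boundary condition -/

/-- Near a solution of the left boundary condition the phase is a `C¹` function of the parameters
and of the speed `s`, and its derivative in `s` exceeds `-1`. The latter holds since
`(θ' + 1) (w'(θ) - ∑ α w'(x)) = w'(θ) + ∑ α η w'(x)` with `|η| < 1`. -/
theorem exists_local_leftPhase (hP : P ∈ Admissible mm mp) (hs : 0 < s)
    (hθ : θ ∈ Ioo 0 (turn P.a P.b 1)) (h : leftDefect P s θ = 0) :
    ∃ φ : Params mm mp × ℝ → ℝ, ContDiffAt ℝ 1 φ (P, s) ∧ φ (P, s) = θ ∧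
      (∀ᶠ q in 𝓝 (P, s), leftDefect q.1 q.2 (φ q) = 0) ∧
      ∃ t, -1 < t ∧ HasDerivAt (fun σ => φ (P, σ)) t s := by
  have hD := deriv_leftDefect_pos hP hs.le hθ h
  obtain ⟨φ, hφ, hφ0, hφz⟩ := exists_implicit_real
    (F := fun q : (Params mm mp × ℝ) × ℝ => leftDefect q.1.1 q.1.2 q.2) (p₀ := (P, s)) (t₀ := θ)
    (contDiffAt_leftDefect (by fun_prop) (by fun_prop) (by fun_prop) hP hs.le hθ.1.le) h
    (hasDerivAt_leftDefect hP hs.le hθ.1.le) hD.ne'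
  have hdiff : DifferentiableAt ℝ (fun σ => φ (P, σ)) s :=
    DifferentiableAt.comp s (g := φ) (f := fun σ => (P, σ))
      (hφ.differentiableAt one_ne_zero) (by fun_prop)
  refine ⟨φ, hφ, hφ0, hφz, _, ?_, hdiff.hasDerivAt⟩
  set t := deriv (fun σ => φ (P, σ)) s
  obtain ⟨ha, hb, hα, -, hη, -⟩ := hP
  have hx : ∀ i, 0 ≤ θ + s * (1 + P.etaM i) := fun i => add_mul_nonneg hθ.1.le hs.le (hη i)
  have h1 : HasDerivAt (fun σ => leftDefect P σ (φ (P, σ)))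
      (t * dwave P.a P.b θ - ∑ i, P.alphaM i *
        ((t + (1 + P.etaM i)) * dwave P.a P.b (θ + s * (1 + P.etaM i)))) s := by
    have := hasDerivAt_defect ha hb (α := P.alphaM) (p := fun σ => φ (P, σ)) (z := s)
      (y := fun i σ => φ (P, σ) + σ * (1 + P.etaM i)) hdiff.hasDerivAt
      (y' := fun i => t + 1 * (1 + P.etaM i))
      (fun i => hdiff.hasDerivAt.add ((hasDerivAt_id s).mul_const _))
      (by rw [hφ0]; exact hθ.1.le) (fun i => by rw [hφ0]; exact hx i)
    simp only [hφ0, one_mul] at this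
    exact this
  have h2 : HasDerivAt (fun σ => leftDefect P σ (φ (P, σ))) 0 s := by
    refine (hasDerivAt_const s (0 : ℝ)).congr_of_eventuallyEq ?_
    exact (ContinuousAt.tendsto (show ContinuousAt (fun σ => (P, σ)) s by fun_prop)).eventually hφz
  have h3 := h1.unique h2
  have h4 := abs_sum_dwave_lt ha hb hα.1 (sum_lt_one_of_mem_Aplus hα) (c := P.etaM)
    (fun i => abs_le_one_of_mem (hη i)) hx hθ.1.le (sub_eq_zero.1 h)
  rw [abs_of_pos (dwave_pos ha hb hθ)] at h4
  have h5 := neg_abs_le (∑ i, P.alphaM i * (P.etaM i * dwave P.a P.b (θ + s * (1 + P.etaM i))))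
  have h6 : ∑ i, P.alphaM i * ((t + (1 + P.etaM i)) * dwave P.a P.b (θ + s * (1 + P.etaM i))) =
      (t + 1) * ∑ i, P.alphaM i * (1 * dwave P.a P.b (θ + s * (1 + P.etaM i))) +
      ∑ i, P.alphaM i * (P.etaM i * dwave P.a P.b (θ + s * (1 + P.etaM i))) := by
    rw [Finset.mul_sum, ← Finset.sum_add_distrib]
    exact Finset.sum_congr rfl fun i _ => by ring
  rw [h6] at h3
  by_contra hcon
  have h7 : t + 1 ≤ 0 := by linarith
  nlinarith [mul_nonneg_of_nonpos_of_nonpos h7 (neg_nonpos.2 hD.le)]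

/-- The phase on the first increasing branch that satisfies the left boundary condition. -/
noncomputable def leftPhase (P : Params mm mp) (s : ℝ) : ℝ :=
  Classical.epsilon fun θ => θ ∈ Ioo 0 (turn P.a P.b 1) ∧ leftDefect P s θ = 0

theorem leftPhase_spec (hP : P ∈ Admissible mm mp) (hs : 0 ≤ s) :
    leftPhase P s ∈ Ioo 0 (turn P.a P.b 1) ∧ leftDefect P s (leftPhase P s) = 0 :=
  Classical.epsilon_spec (existsUnique_leftPhase hP hs).exists

theorem eq_leftPhase (hP : P ∈ Admissible mm mp) (hs : 0 ≤ s) (hθ : θ ∈ Ioo 0 (turn P.a P.b 1))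
    (h : leftDefect P s θ = 0) : θ = leftPhase P s :=
  (existsUnique_leftPhase hP hs).unique ⟨hθ, h⟩ (leftPhase_spec hP hs)

theorem hasDerivAt_leftPhase (hP : P ∈ Admissible mm mp) (hs : 0 < s) :
    ∃ t, -1 < t ∧ HasDerivAt (leftPhase P) t s := by
  obtain ⟨hθ, h0⟩ := leftPhase_spec hP hs.le
  obtain ⟨φ, hφ, hφ0, hφz, t, ht, hd⟩ := exists_local_leftPhase hP hs hθ h0
  refine ⟨t, ht, hd.congr_of_eventuallyEq ?_⟩
  have hc : ContinuousAt (fun σ => (P, σ)) s := by fun_prop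
  have e1 := hc.tendsto.eventually hφz
  have e2 : ∀ᶠ σ in 𝓝 s, φ (P, σ) ∈ Ioo 0 (turn P.a P.b 1) :=
    hd.continuousAt.tendsto.eventually (by rw [hφ0]; exact Ioo_mem_nhds hθ.1 hθ.2)
  filter_upwards [e1, e2, Ioi_mem_nhds hs] with σ h1 h2 h3
  exact (eq_leftPhase hP (mem_Ioi.1 h3).le h2 h1).symm

/-! ### The right boundary condition along the left phase -/

/-- Along any phase whose derivative in `s` exceeds `-1`, a zero of the right defect is
transversal, and the sign of the derivative is that of `w'` there: the derivative equals
`(θ' + 1) (w'(r) - ∑ α w'(y)) + (w'(r) - ∑ α η w'(y))`. -/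
theorem hasDerivAt_rightDefect (hP : P ∈ Admissible mm mp) (hs : 0 < s) {φ : ℝ → ℝ} {t : ℝ}
    (hφ : HasDerivAt φ t s) (ht : -1 < t) (hφ0 : 0 < φ s) :
    ∃ d, HasDerivAt (fun σ => rightDefect P σ (φ σ)) d s ∧
      ∀ k : ℕ, φ s + 2 * s ∈ Ioo (turn P.a P.b k) (turn P.a P.b (k + 1)) →
        rightDefect P s (φ s) = 0 → 0 < (-1) ^ k * d := by
  obtain ⟨ha, hb, -, hα, -, hη⟩ := hP
  have hx : ∀ i, 0 ≤ φ s + s * (1 + P.etaP i) := fun i => add_mul_nonneg hφ0.le hs.le (hη i)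
  have hr0 : 0 ≤ φ s + 2 * s := by positivity
  have h1 := hasDerivAt_defect ha hb (α := P.alphaP) (p := fun σ => φ σ + 2 * σ) (z := s)
      (y := fun i σ => φ σ + σ * (1 + P.etaP i)) (p' := t + 2 * 1)
      (hφ.add ((hasDerivAt_id s).const_mul 2))
      (y' := fun i => t + 1 * (1 + P.etaP i))
      (fun i => hφ.add ((hasDerivAt_id s).mul_const _)) hr0 hx
  refine ⟨_, h1, fun k hk hz => ?_⟩
  have h4 := abs_sum_dwave_lt ha hb hα.1 (sum_lt_one_of_mem_Aplus hα) (c := P.etaP)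
    (fun i => abs_le_one_of_mem (hη i)) hx hr0 (sub_eq_zero.1 hz)
  have h5 := abs_sum_dwave_lt ha hb hα.1 (sum_lt_one_of_mem_Aplus hα) (c := fun _ => 1)
    (by simp) hx hr0 (sub_eq_zero.1 hz)
  have h6 : ∑ i, P.alphaP i * ((t + 1 * (1 + P.etaP i)) *
        dwave P.a P.b (φ s + s * (1 + P.etaP i))) =
      (t + 1) * ∑ i, P.alphaP i * (1 * dwave P.a P.b (φ s + s * (1 + P.etaP i))) +
      ∑ i, P.alphaP i * (P.etaP i * dwave P.a P.b (φ s + s * (1 + P.etaP i))) := by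
    rw [Finset.mul_sum, ← Finset.sum_add_distrib]
    exact Finset.sum_congr rfl fun i _ => by ring
  have h7 := dwave_sign ha hb hk
  rw [h6]
  set A := ∑ i, P.alphaP i * (P.etaP i * dwave P.a P.b (φ s + s * (1 + P.etaP i)))
  set B := ∑ i, P.alphaP i * (1 * dwave P.a P.b (φ s + s * (1 + P.etaP i)))
  set v := dwave P.a P.b (φ s + 2 * s)
  have hsgn : ∀ z : ℝ, |z| < |v| → 0 < (-1) ^ k * (v - z) := fun z hz => by
    rcases Nat.even_or_odd k with h | h
    · rw [h.neg_one_pow, one_mul] at h7 ⊢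
      rw [abs_of_pos h7] at hz
      linarith [le_abs_self z]
    · rw [h.neg_one_pow] at h7 ⊢
      rw [abs_of_neg (show v < 0 by linarith)] at hz
      linarith [neg_abs_le z]
  have e : (-1) ^ k * ((t + 2 * 1) * v - ((t + 1) * B + A)) =
      (t + 1) * ((-1) ^ k * (v - B)) + (-1) ^ k * (v - A) := by ring
  rw [e]
  have := mul_pos (show 0 < t + 1 by linarith) (hsgn B h5)
  linarith [hsgn A h4]

/-- For slow speeds the phase reached at `1` is still on the first increasing branch. -/
theorem exists_endPhase_lt (hP : P ∈ Admissible mm mp) :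
    ∃ s, 0 < s ∧ leftPhase P s + 2 * s < turn P.a P.b 1 := by
  have hP' := hP
  obtain ⟨ha, hb, hα, -, hη, -⟩ := hP'
  set M := turn P.a P.b 1 with hM
  have hM0 : 0 < M := by
    have := turn_strictMono ha hb zero_lt_one
    rwa [turn_zero] at this
  -- for small `s` the left defect is already positive at the phase `M - 2 s`, so its zero is before
  have hc : ContinuousAt (fun s => leftDefect P s (M - 2 * s)) 0 :=
    (contDiffAt_leftDefect (e := (0 : ℝ)) (p := fun _ => P) (σ := fun s => s)
      (φ := fun s => M - 2 * s) contDiffAt_const contDiffAt_id (by fun_prop) hP le_rfl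
      (by simpa using hM0.le)).continuousAt
  have h0 : 0 < leftDefect P 0 (M - 2 * 0) := by
    have := wave_turn_extreme ha hb hα.1 (sum_lt_one_of_mem_Aplus hα) (x := fun _ => M)
      (fun _ => hM0.le) 1
    rw [← hM] at this
    simpa [leftDefect] using this
  have e1 : ∀ᶠ s in 𝓝[>] (0 : ℝ), 0 < leftDefect P s (M - 2 * s) :=
    nhdsWithin_le_nhds (hc.tendsto.eventually_const_lt h0)
  have e2 : ∀ᶠ s in 𝓝[>] (0 : ℝ), s ∈ Ioo 0 (M / 2) := Ioo_mem_nhdsGT (by positivity)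
  obtain ⟨s, h1, h2, h3⟩ := (e1.and e2).exists
  refine ⟨s, h2, ?_⟩
  have hp : 0 ≤ M - 2 * s := by linarith
  obtain ⟨θ, hθ, hz⟩ := intermediate_value_Ioo hp
    (fun x hx => (hasDerivAt_leftDefect hP h2.le hx.1).continuousAt.continuousWithinAt)
    ⟨leftDefect_zero_neg hP h2.le, h1⟩
  rw [← eq_leftPhase hP h2.le ⟨hθ.1, by rw [← hM]; linarith [hθ.2]⟩ hz]
  linarith [hθ.2]

theorem strictMonoOn_endPhase (hP : P ∈ Admissible mm mp) :
    StrictMonoOn (fun s => leftPhase P s + 2 * s) (Ioi 0) := by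
  have hd : ∀ s ∈ Ioi (0 : ℝ), ∃ d, 0 < d ∧ HasDerivAt (fun s => leftPhase P s + 2 * s) d s := by
    intro s hs
    obtain ⟨t, ht, h⟩ := hasDerivAt_leftPhase hP hs
    exact ⟨t + 2 * 1, by linarith, h.add ((hasDerivAt_id s).const_mul 2)⟩
  refine strictMonoOn_of_deriv_pos (convex_Ioi 0) ?_ ?_
  · intro s hs
    obtain ⟨d, -, h⟩ := hd s hs
    exact h.continuousAt.continuousWithinAt
  · intro s hs
    rw [interior_Ioi] at hs
    obtain ⟨d, hd0, h⟩ := hd s hs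
    rwa [h.deriv]

theorem exists_endPhase_eq_turn (hP : P ∈ Admissible mm mp) {k : ℕ} (hk : 1 ≤ k) :
    ∃ s, 0 < s ∧ leftPhase P s + 2 * s = turn P.a P.b k := by
  have hm := turn_strictMono hP.1 hP.2.1
  have hk0 : 0 < turn P.a P.b k := by
    have := hm (show 0 < k by omega)
    rwa [turn_zero] at this
  obtain ⟨s₀, hs₀, h₀⟩ := exists_endPhase_lt hP
  have hc : ContinuousOn (fun s => leftPhase P s + 2 * s) (Ioi 0) := fun s hs => by
    obtain ⟨t, -, h⟩ := hasDerivAt_leftPhase hP hs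
    exact (h.add ((hasDerivAt_id s).const_mul 2)).continuousAt.continuousWithinAt
  have := isPreconnected_Ioi.intermediate_value (mem_Ioi.2 hs₀) (mem_Ioi.2 hk0) hc
  obtain ⟨s, hs, h⟩ := this (show turn P.a P.b k ∈ Icc _ _ from
    ⟨h₀.le.trans (hm.monotone hk), by
      have := (leftPhase_spec hP hk0.le).1.1
      linarith⟩)
  exact ⟨s, hs, h⟩

theorem existsUnique_shooting (hP : P ∈ Admissible mm mp) {k : ℕ} (hk : 1 ≤ k) :
    ∃! s, ∃ θ, Shooting P k s θ := by
  have ha := hP.1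
  have hb := hP.2.1
  have hα := hP.2.2.2.1
  have hη := hP.2.2.2.2.2
  obtain ⟨l, hl0, hl⟩ := exists_endPhase_eq_turn hP hk
  obtain ⟨r, hr0, hr⟩ := exists_endPhase_eq_turn hP (Nat.le_succ_of_le hk)
  have hmono := strictMonoOn_endPhase hP
  have hlr : l < r := by
    rw [← hmono.lt_iff_lt hl0 hr0]
    simp only [hl, hr]
    exact turn_strictMono ha hb (Nat.lt_succ_self k)
  have hmem : ∀ s, 0 < s → (s ∈ Ioo l r ↔
      leftPhase P s + 2 * s ∈ Ioo (turn P.a P.b k) (turn P.a P.b (k + 1))) := fun s hs => by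
    have h1 := hmono.lt_iff_lt hl0 hs
    have h2 := hmono.lt_iff_lt hs hr0
    simp only [hl, hr] at h1 h2
    exact and_congr h1.symm h2.symm
  have hd : ∀ s, 0 < s → ∃ d, HasDerivAt (fun σ => rightDefect P σ (leftPhase P σ)) d s ∧
      ∀ k : ℕ, leftPhase P s + 2 * s ∈ Ioo (turn P.a P.b k) (turn P.a P.b (k + 1)) →
        rightDefect P s (leftPhase P s) = 0 → 0 < (-1) ^ k * d := fun s hs => by
    obtain ⟨t, ht, h⟩ := hasDerivAt_leftPhase hP hs
    exact hasDerivAt_rightDefect hP hs h ht (leftPhase_spec hP hs.le).1.1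
  choose! d hd1 hd2 using hd
  have hpos : ∀ s ∈ Icc l r, 0 < s := fun s hs => hl0.trans_le hs.1
  have hend : ∀ s, 0 < s → ∀ n, leftPhase P s + 2 * s = turn P.a P.b n →
      (-1) ^ n * rightDefect P s (leftPhase P s) < 0 := fun s hs n hn => by
    rw [rightDefect, hn]
    exact wave_turn_extreme ha hb hα.1 (sum_lt_one_of_mem_Aplus hα)
      (fun i => add_mul_nonneg (leftPhase_spec hP hs.le).1.1.le hs.le (hη i)) n
  obtain ⟨s, ⟨hs, hz⟩, huniq⟩ := existsUnique_zero_of_crossing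
    (f := fun s => (-1) ^ k * rightDefect P s (leftPhase P s)) (f' := fun s => (-1) ^ k * d s) hlr
    (fun s hs => ((hd1 s (hpos s hs)).const_mul _).continuousAt.continuousWithinAt)
    (hend l hl0 k hl) (by have := hend r hr0 (k + 1) hr; rw [pow_succ] at this; linarith)
    (fun s hs => (hd1 s (hpos s (Ioo_subset_Icc_self hs))).const_mul _)
    (fun s hs h => by
      have hs0 := hpos s (Ioo_subset_Icc_self hs)
      exact hd2 s hs0 k ((hmem s hs0).1 hs) (by simpa using h))
  have hs0 := hpos s (Ioo_subset_Icc_self hs)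
  refine ⟨s, ⟨leftPhase P s, hs0, (leftPhase_spec hP hs0.le).1, (hmem s hs0).1 hs,
    (leftPhase_spec hP hs0.le).2, by simpa using hz⟩, ?_⟩
  rintro σ ⟨θ, hσ, h1, h2, h3, h4⟩
  obtain rfl := eq_leftPhase hP hσ.le h1 h3
  exact huniq σ ⟨(hmem σ hσ).2 h2, by simp [h4]⟩

/-- Near admissible parameters the shooting system has a solution whose speed is a `C¹` function
on a full neighbourhood in the parameter space, so that the part of the boundary with some
`α_i = 0` needs no separate treatment. -/
theorem exists_local_shooting (hP : P ∈ Admissible mm mp) {k : ℕ} (h : Shooting P k s θ) :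
    ∃ σ : Params mm mp → ℝ, ContDiffAt ℝ 1 σ P ∧
      ∀ᶠ Q in 𝓝 P, ∃ θ, Shooting Q k (σ Q) θ := by
  obtain ⟨hs, hθ, hr, hl0, hr0⟩ := h
  obtain ⟨φ, hφ, hφ0, hφz, t, ht, hd⟩ := exists_local_leftPhase hP hs hθ hl0
  obtain ⟨d, hd1, hd2⟩ := hasDerivAt_rightDefect hP hs hd ht (by rw [hφ0]; exact hθ.1)
  have hd0 := hd2 k (by rw [hφ0]; exact hr) (by rw [hφ0]; exact hr0)
  obtain ⟨σ, hσ, hσ0, hσz⟩ := exists_implicit_real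
    (F := fun q : Params mm mp × ℝ => rightDefect q.1 q.2 (φ q)) (p₀ := P) (t₀ := s)
    (contDiffAt_rightDefect contDiffAt_fst contDiffAt_snd hφ hP hs.le
      (by rw [hφ0]; exact hθ.1.le)) (by simp only; rw [hφ0]; exact hr0) hd1
    (right_ne_zero_of_mul hd0.ne')
  refine ⟨σ, hσ, ?_⟩
  have hpair : ContinuousAt (fun Q => (Q, σ Q)) P := continuousAt_id.prodMk hσ.continuousAt
  have htend : Tendsto (fun Q => (Q, σ Q)) (𝓝 P) (𝓝 (P, s)) := by
    simpa only [ContinuousAt, hσ0] using hpair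
  have hφc : ContinuousAt (fun Q => φ (Q, σ Q)) P := by
    have : Tendsto (fun Q => φ (Q, σ Q)) (𝓝 P) (𝓝 (φ (P, s))) :=
      hφ.continuousAt.tendsto.comp htend
    simpa only [ContinuousAt, hσ0] using this
  have hturn : ∀ n, ContinuousAt (fun Q : Params mm mp => turn Q.a Q.b n) P := fun n =>
    ContinuousAt.comp (g := fun q : ℝ × ℝ => turn q.1 q.2 n)
      (f := fun Q : Params mm mp => (Q.a, Q.b)) (contDiffAt_turn hP.1 hP.2.1 n).continuousAt
      (contDiff_params_a.continuous.prodMk contDiff_params_b.continuous).continuousAt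
  have hend : ContinuousAt (fun Q => φ (Q, σ Q) + 2 * σ Q) P :=
    hφc.add (hσ.continuousAt.const_mul 2)
  have v0 : φ (P, σ P) = θ := by rw [hσ0, hφ0]
  have e1 := hσ.continuousAt.eventually_const_lt (show 0 < σ P by rwa [hσ0])
  have e2 := hφc.eventually_const_lt (show 0 < φ (P, σ P) by rw [v0]; exact hθ.1)
  have e3 := hφc.eventually_lt (hturn 1) (by rw [v0]; exact hθ.2)
  have e4 := (hturn k).eventually_lt hend (by rw [v0, hσ0]; exact hr.1)
  have e5 := hend.eventually_lt (hturn (k + 1)) (by rw [v0, hσ0]; exact hr.2)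
  filter_upwards [e1, e2, e3, e4, e5, htend.eventually hφz, hσz] with Q q1 q2 q3 q4 q5 q6 q7
  exact ⟨φ (Q, σ Q), q1, ⟨q2, q3⟩, ⟨q4, q5⟩, q6, q7⟩

end defect

/-! ### Half-eigenfunctions are rescaled waves -/

section equation

theorem uniqueDiffOn_I : UniqueDiffOn ℝ I := uniqueDiffOn_Icc (by norm_num)

theorem Ioo_subset_I : Ioo (-1 : ℝ) 1 ⊆ I := Ioo_subset_Icc_self

theorem contDiffOn_two_iff {u : ℝ → ℝ} : ContDiffOn ℝ 2 u I ↔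
    DifferentiableOn ℝ u I ∧ DifferentiableOn ℝ (d1 u) I ∧ ContinuousOn (d2 u) I := by
  rw [show (2 : WithTop ℕ∞) = 1 + 1 by norm_num, contDiffOn_succ_iff_derivWithin uniqueDiffOn_I,
    show (1 : WithTop ℕ∞) = 0 + 1 by norm_num, contDiffOn_succ_iff_derivWithin uniqueDiffOn_I,
    contDiffOn_zero]
  simp [d1, d2]

variable {a b : ℝ}

theorem force_mul {A : ℝ} (hA : 0 ≤ A) (w : ℝ) : force a b (A * w) = A * force a b w := by
  have h1 : max (A * w) 0 = A * max w 0 := by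
    rw [mul_max_of_nonneg _ _ hA, mul_zero]
  have h2 : max (-(A * w)) 0 = A * max (-w) 0 := by
    rw [mul_max_of_nonneg _ _ hA, mul_zero, mul_neg]
  rw [force, h1, h2, force]; ring

theorem gauge_mul {A : ℝ} (hA : 0 ≤ A) (w : ℝ) : gauge a b (A * w) = A * gauge a b w := by
  have h1 : max (A * w) 0 = A * max w 0 := by
    rw [mul_max_of_nonneg _ _ hA, mul_zero]
  have h2 : max (-(A * w)) 0 = A * max (-w) 0 := by
    rw [mul_max_of_nonneg _ _ hA, mul_zero, mul_neg]
  rw [gauge, h1, h2, gauge]; ring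

theorem continuous_force : Continuous (force a b) := by
  unfold force; fun_prop

theorem mul_force_nonneg (ha : 0 < a) (hb : 0 < b) (w : ℝ) : 0 ≤ w * force a b w := by
  rcases le_total 0 w with h | h
  · rw [force, max_eq_left h, max_eq_right (by linarith)]
    nlinarith [mul_nonneg ha.le (mul_nonneg h h)]
  · rw [force, max_eq_right h, max_eq_left (by linarith)]
    nlinarith [mul_nonneg hb.le (mul_self_nonneg w)]

theorem abs_force_sub_le (ha : 0 < a) (hb : 0 < b) (w z : ℝ) :
    |force a b w - force a b z| ≤ (a + b) * |w - z| := by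
  have h1 := abs_max_sub_max_le_abs w z 0
  have h2 := abs_max_sub_max_le_abs (-w) (-z) 0
  rw [show -w - -z = -(w - z) by ring, abs_neg] at h2
  calc |force a b w - force a b z|
      = |a * (max w 0 - max z 0) - b * (max (-w) 0 - max (-z) 0)| := by
        congr 1; unfold force; ring
    _ ≤ |a * (max w 0 - max z 0)| + |b * (max (-w) 0 - max (-z) 0)| := abs_sub _ _
    _ = a * |max w 0 - max z 0| + b * |max (-w) 0 - max (-z) 0| := by
        rw [abs_mul, abs_mul, abs_of_pos ha, abs_of_pos hb]
    _ ≤ a * |w - z| + b * |w - z| := by gcongr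
    _ = (a + b) * |w - z| := by ring

theorem gauge_lt_one_iff (ha : 0 < a) (hb : 0 < b) {w : ℝ} :
    gauge a b w < 1 ↔ w ∈ Ioo (-1 / √b) (1 / √a) := by
  rw [gauge_eq_max, max_lt_iff, mem_Ioo, div_lt_iff₀ (Real.sqrt_pos.2 hb),
    lt_div_iff₀ (Real.sqrt_pos.2 ha), and_comm]
  exact and_congr ⟨fun h => by linarith, fun h => by linarith⟩
    ⟨fun h => by linarith, fun h => by linarith⟩

/-- Every state with positive velocity is a rescaled state of the wave on its first increasing
branch. -/
theorem exists_amplitude_phase (ha : 0 < a) (hb : 0 < b) {w v : ℝ} (hv : 0 < v) :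
    ∃ A θ, 0 < A ∧ θ ∈ Ioo 0 (turn a b 1) ∧ A * wave a b θ = w ∧ A * dwave a b θ = v := by
  -- the amplitude is determined by the energy, since the wave has energy `1`
  set A := √(v ^ 2 + gauge a b w ^ 2) with hA
  have hA2 : A ^ 2 = v ^ 2 + gauge a b w ^ 2 := Real.sq_sqrt (by positivity)
  have hA0 : 0 < A := Real.sqrt_pos.2 (by positivity)
  have hg : gauge a b (A⁻¹ * w) = A⁻¹ * gauge a b w := gauge_mul (by positivity) w
  have hg1 : gauge a b (A⁻¹ * w) < 1 := by
    rw [hg, inv_mul_lt_iff₀ hA0, mul_one]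
    refine lt_of_pow_lt_pow_left₀ 2 hA0.le ?_
    have : 0 < v ^ 2 := by positivity
    linarith
  have hm : 0 < turn a b 1 := by
    have := turn_strictMono ha hb zero_lt_one
    rwa [turn_zero] at this
  have h0 : wave a b 0 = -1 / √b := by
    have := wave_turn ha hb 0
    rw [turn_zero] at this
    simpa [freq] using this
  have h1 : wave a b (turn a b 1) = 1 / √a := by
    rw [wave_turn ha hb 1]; simp [freq]
  obtain ⟨θ, hθ, hw⟩ := intermediate_value_Ioo hm.le
    (fun x hx => (hasDerivAt_wave ha hb hx.1).continuousAt.continuousWithinAt)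
    (by rw [h0, h1]; exact (gauge_lt_one_iff ha hb).1 hg1)
  refine ⟨A, θ, hA0, hθ, ?_, ?_⟩
  · rw [hw, mul_inv_cancel_left₀ hA0.ne']
  · have he := wave_energy ha hb hθ.1.le
    rw [hw, hg] at he
    have hd := dwave_pos ha hb hθ
    have : (A * dwave a b θ) ^ 2 = v ^ 2 := by
      have h2 : (A * (A⁻¹ * gauge a b w)) ^ 2 = gauge a b w ^ 2 := by
        rw [mul_inv_cancel_left₀ hA0.ne']
      rw [mul_pow] at h2 ⊢
      have h3 : A ^ 2 * dwave a b θ ^ 2 + A ^ 2 * (A⁻¹ * gauge a b w) ^ 2 = A ^ 2 := by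
        rw [← mul_add, he, mul_one]
      linarith
    exact (pow_left_inj₀ (by positivity) hv.le two_ne_zero).1 this

/-- The right-hand side of the first order system of `-u'' = lam (a u⁺ - b u⁻)`. -/
noncomputable def phaseField (a b lam : ℝ) (p : ℝ × ℝ) : ℝ × ℝ := (p.2, -(lam * force a b p.1))

theorem lipschitzWith_phaseField (ha : 0 < a) (hb : 0 < b) {lam : ℝ} (hl : 0 < lam) :
    LipschitzWith (Real.toNNReal (1 + lam * (a + b))) (phaseField a b lam) := by
  refine LipschitzWith.of_dist_le_mul fun p q => ?_
  have hK : 0 ≤ lam * (a + b) := by positivity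
  rw [Real.coe_toNNReal _ (by linarith), Prod.dist_eq, Prod.dist_eq]
  have h0 : 0 ≤ max (dist p.1 q.1) (dist p.2 q.2) := le_max_of_le_left dist_nonneg
  refine max_le ?_ ?_
  · have h1 := le_max_right (dist p.1 q.1) (dist p.2 q.2)
    simp only [phaseField]
    nlinarith
  · have h1 := le_max_left (dist p.1 q.1) (dist p.2 q.2)
    have h2 := abs_force_sub_le ha hb p.1 q.1
    have h3 : dist (phaseField a b lam p).2 (phaseField a b lam q).2 =
        lam * |force a b p.1 - force a b q.1| := by
      simp only [phaseField]
      rw [Real.dist_eq, ← abs_of_pos hl, ← abs_mul, abs_of_pos hl, ← abs_neg]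
      congr 1; ring
    rw [h3]
    rw [Real.dist_eq p.1] at h1 h0 ⊢
    calc lam * |force a b p.1 - force a b q.1| ≤ lam * ((a + b) * |p.1 - q.1|) := by gcongr
      _ = lam * (a + b) * |p.1 - q.1| := by ring
      _ ≤ lam * (a + b) * max |p.1 - q.1| (dist p.2 q.2) := by gcongr
      _ ≤ _ := by linarith

theorem hasDerivAt_wave_comp (ha : 0 < a) (hb : 0 < b) {s θ x : ℝ} (h : 0 ≤ θ + s * (1 + x)) :
    HasDerivAt (fun x => wave a b (θ + s * (1 + x))) (s * dwave a b (θ + s * (1 + x))) x := by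
  have h1 : HasDerivAt (fun x => θ + s * (1 + x)) s x := by
    simpa using (((hasDerivAt_id x).const_add 1).const_mul s).const_add θ
  rw [mul_comm]
  exact (hasDerivAt_wave ha hb h).comp x h1

theorem hasDerivAt_dwave_comp (ha : 0 < a) (hb : 0 < b) {s θ x : ℝ} (h : 0 ≤ θ + s * (1 + x)) :
    HasDerivAt (fun x => s * dwave a b (θ + s * (1 + x)))
      (-(s ^ 2 * force a b (wave a b (θ + s * (1 + x))))) x := by
  have h1 : HasDerivAt (fun x => θ + s * (1 + x)) s x := by
    simpa using (((hasDerivAt_id x).const_add 1).const_mul s).const_add θ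
  have h2 : HasDerivAt (fun x => dwave a b (θ + s * (1 + x)))
      (-force a b (wave a b (θ + s * (1 + x))) * s) x :=
    HasDerivAt.comp (h₂ := dwave a b) (h := fun x => θ + s * (1 + x)) x
      (hasDerivAt_dwave ha hb h) h1
  exact (h2.const_mul s).congr_deriv (by ring)

theorem phase_nonneg {s θ x : ℝ} (hs : 0 ≤ s) (hθ : 0 ≤ θ) (hx : x ∈ I) :
    0 ≤ θ + s * (1 + x) := add_nonneg hθ (mul_nonneg hs (by linarith [hx.1]))

theorem d1_wave_comp (ha : 0 < a) (hb : 0 < b) {s θ x : ℝ} (hs : 0 ≤ s) (hθ : 0 ≤ θ)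
    (hx : x ∈ I) : d1 (fun x => wave a b (θ + s * (1 + x))) x =
      s * dwave a b (θ + s * (1 + x)) :=
  (hasDerivAt_wave_comp ha hb (phase_nonneg hs hθ hx)).hasDerivWithinAt.derivWithin
    (uniqueDiffOn_I x hx)

theorem hasDerivWithinAt_d1_wave_comp (ha : 0 < a) (hb : 0 < b) {s θ x : ℝ} (hs : 0 ≤ s)
    (hθ : 0 ≤ θ) (hx : x ∈ I) : HasDerivWithinAt (d1 (fun x => wave a b (θ + s * (1 + x))))
      (-(s ^ 2 * force a b (wave a b (θ + s * (1 + x))))) I x :=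
  (hasDerivAt_dwave_comp ha hb (phase_nonneg hs hθ hx)).hasDerivWithinAt.congr
    (fun _ hy => d1_wave_comp ha hb hs hθ hy) (d1_wave_comp ha hb hs hθ hx)

theorem d2_wave_comp (ha : 0 < a) (hb : 0 < b) {s θ x : ℝ} (hs : 0 ≤ s) (hθ : 0 ≤ θ)
    (hx : x ∈ I) : d2 (fun x => wave a b (θ + s * (1 + x))) x =
      -(s ^ 2 * force a b (wave a b (θ + s * (1 + x)))) :=
  (hasDerivWithinAt_d1_wave_comp ha hb hs hθ hx).derivWithin (uniqueDiffOn_I x hx)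

theorem contDiffOn_wave_comp (ha : 0 < a) (hb : 0 < b) {s θ : ℝ} (hs : 0 ≤ s) (hθ : 0 ≤ θ) :
    ContDiffOn ℝ 2 (fun x => wave a b (θ + s * (1 + x))) I := by
  have hc : ∀ x ∈ I, DifferentiableAt ℝ (fun x => wave a b (θ + s * (1 + x))) x := fun x hx =>
    (hasDerivAt_wave_comp ha hb (phase_nonneg hs hθ hx)).differentiableAt
  refine contDiffOn_two_iff.2 ⟨fun x hx => (hc x hx).differentiableWithinAt,
    fun x hx => (hasDerivWithinAt_d1_wave_comp ha hb hs hθ hx).differentiableWithinAt, ?_⟩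
  refine ContinuousOn.congr ?_ fun x hx => d2_wave_comp ha hb hs hθ hx
  refine (continuousOn_const.mul (continuous_force.comp_continuousOn ?_)).neg
  exact fun x hx => (hc x hx).continuousAt.continuousWithinAt

/-- With the phase starting on the first branch and ending on the `n`-th one, the derivative of
the rescaled wave has exactly `n` interior zeros. -/
theorem encard_zeros (ha : 0 < a) (hb : 0 < b) {s θ : ℝ} {n : ℕ} (hs : 0 < s)
    (hθ : θ ∈ Ioo 0 (turn a b 1)) (hr : θ + 2 * s ∈ Ioo (turn a b n) (turn a b (n + 1))) :
    {x | x ∈ Ioo (-1 : ℝ) 1 ∧ dwave a b (θ + s * (1 + x)) = 0}.encard = n := by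
  have hm := turn_strictMono ha hb
  have hset : {x | x ∈ Ioo (-1 : ℝ) 1 ∧ dwave a b (θ + s * (1 + x)) = 0} =
      (fun j => (turn a b j - θ) / s - 1) '' (Finset.Icc 1 n : Finset ℕ) := by
    ext x
    simp only [mem_ofPred_eq, mem_image, Finset.coe_Icc, mem_Icc]
    constructor
    · rintro ⟨hx, h⟩
      obtain ⟨j, hj⟩ := (dwave_eq_zero_iff ha hb
        (phase_nonneg hs.le hθ.1.le (Ioo_subset_I hx))).1 h
      have h1 : 0 < s * (1 + x) := mul_pos hs (by linarith [hx.1])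
      have h2 : s * (1 + x) < 2 * s := by nlinarith [hx.2]
      refine ⟨j, ⟨?_, ?_⟩, ?_⟩
      · by_contra hcon
        rw [show j = 0 by omega, turn_zero] at hj
        linarith [hθ.1]
      · have : turn a b j < turn a b (n + 1) := by rw [← hj]; linarith [hr.2]
        have := hm.lt_iff_lt.1 this
        omega
      · rw [← hj]; field_simp; ring
    · rintro ⟨j, ⟨h1, h2⟩, rfl⟩
      have e : θ + s * (1 + ((turn a b j - θ) / s - 1)) = turn a b j := by field_simp; ring
      have h3 := hm.monotone h1
      have h4 := hm.monotone h2
      refine ⟨⟨?_, ?_⟩, ?_⟩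
      · have : 0 < (turn a b j - θ) / s := div_pos (by linarith [hθ.2]) hs
        linarith
      · have : (turn a b j - θ) / s < 2 := by rw [div_lt_iff₀ hs]; linarith [hr.1]
        linarith
      · rw [e, dwave_turn ha hb]
  have hinj : Function.Injective (fun j => (turn a b j - θ) / s - 1) := fun i j h => by
    have h1 : (turn a b i - θ) / s - 1 = (turn a b j - θ) / s - 1 := h
    have h2 : turn a b i - θ = turn a b j - θ := by
      field_simp at h1
      linarith
    exact hm.injective (by linarith)
  rw [hset, hinj.encard_image, encard_coe_eq_coe_finsetCard]
  simp

variable {mm mp : ℕ} {P : Params mm mp} {k : ℕ} {lam : ℝ} {u : ℝ → ℝ}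

theorem hasDerivWithinAt_d1 (hu : ContDiffOn ℝ 2 u I) {x : ℝ} (hx : x ∈ I) :
    HasDerivWithinAt u (d1 u x) I x := ((contDiffOn_two_iff.1 hu).1 x hx).hasDerivWithinAt

theorem hasDerivWithinAt_d2 (hu : ContDiffOn ℝ 2 u I) {x : ℝ} (hx : x ∈ I) :
    HasDerivWithinAt (d1 u) (d2 u x) I x :=
  ((contDiffOn_two_iff.1 hu).2.1 x hx).hasDerivWithinAt

/-- By continuity the equation holds at the end points as well. -/
theorem IsHalfEigenfunction.d2_eq (h : IsHalfEigenfunction P lam u) {x : ℝ} (hx : x ∈ I) :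
    d2 u x = -(lam * force P.a P.b (u x)) := by
  have hu := h.1.1
  have heq : EqOn (d2 u) (fun x => -(lam * force P.a P.b (u x))) (Ioo (-1) 1) := fun x hx => by
    have := h.2.2 x hx
    simp only [force]
    linarith
  refine heq.of_subset_closure (contDiffOn_two_iff.1 hu).2.2
    (continuousOn_const.mul (continuous_force.comp_continuousOn hu.continuousOn)).neg
    Ioo_subset_I ?_ hx
  rw [closure_Ioo (by norm_num)]

theorem abs_sum_mul_le {m : ℕ} {α z : Fin m → ℝ} {M : ℝ} (hα : ∀ i, 0 ≤ α i)
    (hz : ∀ i, |z i| ≤ M) : |∑ i, α i * z i| ≤ (∑ i, α i) * M := by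
  rw [Finset.sum_mul]
  refine (Finset.abs_sum_le_sum_abs _ _).trans (Finset.sum_le_sum fun i _ => ?_)
  rw [abs_mul, abs_of_nonneg (hα i)]
  exact mul_le_mul_of_nonneg_left (hz i) (hα i)

/-- Half-eigenvalues are positive: otherwise `u²` is convex, so `|u|` attains its maximum at an
end point, where the boundary condition makes it strictly smaller. -/
theorem IsHalfEigenfunction.pos (hP : P ∈ Admissible mm mp) (h : IsHalfEigenfunction P lam u) :
    0 < lam := by
  obtain ⟨ha, hb, hαm, hαp, hηm, hηp⟩ := hP
  by_contra hcon
  have hl : lam ≤ 0 := not_lt.1 hcon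
  have hu := h.1.1
  have hin : interior I = Ioo (-1 : ℝ) 1 := interior_Icc
  have hconv : ConvexOn ℝ I (fun x => u x * u x) := by
    refine convexOn_of_hasDerivWithinAt2_nonneg (convex_Icc _ _)
      (hu.continuousOn.mul hu.continuousOn)
      (f' := fun x => d1 u x * u x + u x * d1 u x)
      (f'' := fun x => d2 u x * u x + d1 u x * d1 u x + (d1 u x * d1 u x + u x * d2 u x))
      (fun x hx => ?_) (fun x hx => ?_) (fun x hx => ?_)
    · have h1 := (hasDerivWithinAt_d1 hu (interior_subset hx)).mono interior_subset
      exact h1.mul h1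
    · have h1 := (hasDerivWithinAt_d1 hu (interior_subset hx)).mono interior_subset
      have h2 := (hasDerivWithinAt_d2 hu (interior_subset hx)).mono interior_subset
      exact (h2.mul h1).add (h1.mul h2)
    · have h1 := h.d2_eq (interior_subset hx)
      have h2 := mul_nonneg (neg_nonneg.2 hl) (mul_force_nonneg ha hb (u x))
      have h3 := mul_self_nonneg (d1 u x)
      rw [h1]
      linarith
  set M := max |u (-1)| |u 1| with hM
  have hbound : ∀ x ∈ I, |u x| ≤ M := fun x hx => by
    have h1 := hconv.le_max_of_mem_Icc (left_mem_Icc.2 (by norm_num))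
      (right_mem_Icc.2 (by norm_num)) hx
    rcases le_max_iff.1 h1 with h2 | h2
    · exact (abs_le_iff_mul_self_le.2 h2).trans (le_max_left _ _)
    · exact (abs_le_iff_mul_self_le.2 h2).trans (le_max_right _ _)
  have hl1 : |u (-1)| ≤ (∑ i, P.alphaM i) * M := by
    rw [h.1.2.1]
    exact abs_sum_mul_le hαm.1 fun i => hbound _ (Ioo_subset_I (hηm i))
  have hr1 : |u 1| ≤ (∑ i, P.alphaP i) * M := by
    rw [h.1.2.2]
    exact abs_sum_mul_le hαp.1 fun i => hbound _ (Ioo_subset_I (hηp i))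
  have hM0 : 0 < M := by
    obtain ⟨x, hx, hne⟩ := h.2.1
    exact (abs_pos.2 hne).trans_le (hbound x hx)
  have h1 : M < M := by
    conv_lhs => rw [hM]
    refine max_lt (hl1.trans_lt ?_) (hr1.trans_lt ?_)
    · exact mul_lt_of_lt_one_left hM0 (sum_lt_one_of_mem_Aplus hαm)
    · exact mul_lt_of_lt_one_left hM0 (sum_lt_one_of_mem_Aplus hαp)
  exact lt_irrefl _ h1

/-- A half-eigenfunction that increases at `-1` is a rescaled wave. -/
theorem IsHalfEigenfunction.eq_wave (hP : P ∈ Admissible mm mp) (h : IsHalfEigenfunction P lam u)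
    (hv : 0 < d1 u (-1)) :
    ∃ A s θ, 0 < A ∧ 0 < s ∧ lam = s ^ 2 ∧ θ ∈ Ioo 0 (turn P.a P.b 1) ∧
      ∀ x ∈ I, u x = A * wave P.a P.b (θ + s * (1 + x)) ∧
        d1 u x = A * (s * dwave P.a P.b (θ + s * (1 + x))) := by
  have hl := h.pos hP
  have ha := hP.1
  have hb := hP.2.1
  have hu := h.1.1
  set s := √lam with hs
  have hs0 : 0 < s := Real.sqrt_pos.2 hl
  have hs2 : lam = s ^ 2 := (Real.sq_sqrt hl.le).symm
  obtain ⟨A, θ, hA, hθ, h1, h2⟩ :=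
    exists_amplitude_phase ha hb (w := u (-1)) (v := d1 u (-1) / s) (div_pos hv hs0)
  refine ⟨A, s, θ, hA, hs0, hs2, hθ, ?_⟩
  have hIci : ∀ x ∈ Ico (-1 : ℝ) 1, ∀ {f : ℝ → ℝ} {f' : ℝ}, HasDerivWithinAt f f' I x →
      HasDerivWithinAt f f' (Ici x) x := fun x hx f f' hf =>
    hf.mono_of_mem_nhdsWithin (by
      filter_upwards [Icc_mem_nhdsGE hx.2] with y hy using ⟨hx.1.trans hy.1, hy.2⟩)
  have hw : ∀ x ∈ I, HasDerivAt (fun x => A * wave P.a P.b (θ + s * (1 + x)))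
      (A * (s * dwave P.a P.b (θ + s * (1 + x)))) x := fun x hx =>
    (hasDerivAt_wave_comp ha hb (phase_nonneg hs0.le hθ.1.le hx)).const_mul A
  have hw' : ∀ x ∈ I, HasDerivAt (fun x => A * (s * dwave P.a P.b (θ + s * (1 + x))))
      (-(lam * force P.a P.b (A * wave P.a P.b (θ + s * (1 + x))))) x := fun x hx =>
    ((hasDerivAt_dwave_comp ha hb (phase_nonneg hs0.le hθ.1.le hx)).const_mul A).congr_deriv (by
      rw [force_mul hA.le, hs2]; ring)
  have key := ODE_solution_unique (v := fun _ => phaseField P.a P.b lam) (a := -1) (b := 1)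
    (f := fun x => (u x, d1 u x))
    (g := fun x => (A * wave P.a P.b (θ + s * (1 + x)),
      A * (s * dwave P.a P.b (θ + s * (1 + x)))))
    (fun _ => lipschitzWith_phaseField ha hb hl)
    (hu.continuousOn.prodMk (contDiffOn_two_iff.1 hu).2.1.continuousOn)
    (fun x hx => by
      have hxI : x ∈ I := Ico_subset_Icc_self hx
      refine (hIci x hx (hasDerivWithinAt_d1 hu hxI)).prodMk ?_
      have := hIci x hx (hasDerivWithinAt_d2 hu hxI)
      rwa [h.d2_eq hxI] at this)
    (fun x hx => ((hw x hx).continuousAt.prodMk (hw' x hx).continuousAt).continuousWithinAt)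
    (fun x hx => by
      have hxI : x ∈ I := Ico_subset_Icc_self hx
      exact (hw x hxI).hasDerivWithinAt.prodMk (hw' x hxI).hasDerivWithinAt)
    (by
      have e : θ + s * (1 + -1) = θ := by ring
      simp only [e, h1]
      rw [mul_left_comm, h2, mul_div_cancel₀ _ hs0.ne'])
  intro x hx
  exact Prod.mk.inj (key hx)

theorem isHalfEigenvalueOf_one_iff (hP : P ∈ Admissible mm mp) :
    IsHalfEigenvalueOf k 1 P lam ↔ ∃ s θ, lam = s ^ 2 ∧ Shooting P k s θ := by
  have hP' := hP
  obtain ⟨ha, hb, hαm, hαp, hηm, hηp⟩ := hP'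
  have el : ∀ s θ : ℝ, θ + s * (1 + -1) = θ := fun s θ => by ring
  have er : ∀ s θ : ℝ, θ + s * (1 + 1) = θ + 2 * s := fun s θ => by ring
  constructor
  · rintro ⟨u, hu, -, ⟨-, hr, hl⟩, ⟨-, hcard⟩, -⟩
    simp only [Units.val_one, Int.cast_one, one_mul] at hl
    obtain ⟨A, s, θ, hA, hs, hlam, hθ, hx⟩ := hu.eq_wave hP hl
    refine ⟨s, θ, hlam, hs, hθ, ?_, ?_, ?_⟩
    · obtain ⟨n, h1, h2⟩ := exists_turn_Ico ha hb (x := θ + 2 * s) (by linarith [hθ.1])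
      have h3 : turn P.a P.b n < θ + 2 * s := by
        refine lt_of_le_of_ne h1 fun h => hr ?_
        rw [(hx 1 (right_mem_Icc.2 (by norm_num))).2, er, ← h, dwave_turn ha hb]
        simp
      have h4 := encard_zeros ha hb hs hθ ⟨h3, h2⟩
      have h5 : {x | x ∈ Ioo (-1 : ℝ) 1 ∧ d1 u x = 0} =
          {x | x ∈ Ioo (-1 : ℝ) 1 ∧ dwave P.a P.b (θ + s * (1 + x)) = 0} := by
        ext x
        simp only [mem_ofPred_eq]
        refine and_congr_right fun h => ?_
        rw [(hx x (Ioo_subset_I h)).2]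
        simp [hA.ne', hs.ne']
      rw [h5, h4] at hcard
      obtain rfl : n = k := by exact_mod_cast hcard
      exact ⟨h3, h2⟩
    · have h1 := hu.1.2.1
      rw [(hx (-1) (left_mem_Icc.2 (by norm_num))).1, el] at h1
      simp only [fun i => (hx _ (Ioo_subset_I (hηm i))).1, mul_left_comm _ A,
        ← Finset.mul_sum] at h1
      rw [leftDefect, mul_left_cancel₀ hA.ne' h1, sub_self]
    · have h1 := hu.1.2.2
      rw [(hx 1 (right_mem_Icc.2 (by norm_num))).1, er] at h1
      simp only [fun i => (hx _ (Ioo_subset_I (hηp i))).1, mul_left_comm _ A,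
        ← Finset.mul_sum] at h1
      rw [rightDefect, mul_left_cancel₀ hA.ne' h1, sub_self]
  · rintro ⟨s, θ, rfl, hs, hθ, hr, hl0, hr0⟩
    have hX : (fun x => wave P.a P.b (θ + s * (1 + x))) ∈ X P := by
      refine ⟨contDiffOn_wave_comp ha hb hs.le hθ.1.le, ?_, ?_⟩
      · simp only [el]; exact sub_eq_zero.1 hl0
      · simp only [er]; exact sub_eq_zero.1 hr0
    have hd1 := fun x hx => d1_wave_comp ha hb hs.le hθ.1.le (x := x) hx
    have hd2 := fun x hx => d2_wave_comp ha hb hs.le hθ.1.le (x := x) hx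
    have hcrit : ∀ x ∈ Ioo (-1 : ℝ) 1, d1 (fun x => wave P.a P.b (θ + s * (1 + x))) x = 0 →
        ∃ j, θ + s * (1 + x) = turn P.a P.b j := fun x hx h => by
      rw [hd1 x (Ioo_subset_I hx)] at h
      exact (dwave_eq_zero_iff ha hb (phase_nonneg hs.le hθ.1.le (Ioo_subset_I hx))).1
        ((mul_eq_zero.1 h).resolve_left hs.ne')
    refine ⟨fun x => wave P.a P.b (θ + s * (1 + x)), ⟨hX, ?_, ?_⟩, hX, ?_, ⟨?_, ?_⟩, ?_⟩
    · -- the first derivative does not vanish at `-1`, so the function is not identically zero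
      by_contra! hcon
      have h0 : d1 (fun x => wave P.a P.b (θ + s * (1 + x))) (-1) = 0 := by
        rw [d1, derivWithin_congr (f := fun _ => (0 : ℝ)) hcon
          (hcon _ (left_mem_Icc.2 (by norm_num)))]
        simp
      rw [hd1 _ (left_mem_Icc.2 (by norm_num)), el] at h0
      exact (mul_pos hs (dwave_pos ha hb hθ)).ne' h0
    · intro x hx
      rw [hd2 x (Ioo_subset_I hx), neg_neg, force]
    · rw [hd1 _ (left_mem_Icc.2 (by norm_num)), hd1 _ (right_mem_Icc.2 (by norm_num)), el, er]
      have h1 := mul_pos hs (dwave_pos ha hb hθ)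
      refine ⟨h1.ne', mul_ne_zero hs.ne' fun h => ?_, by simpa using h1⟩
      have h2 := dwave_sign ha hb hr
      simp [h] at h2
    · intro x hx h
      obtain ⟨j, hj⟩ := hcrit x hx h
      have hc := (freq_pos ha hb j).ne'
      have ht := turn_mem_arc ha hb j
      rw [hd2 x (Ioo_subset_I hx), hj, wave_eq_arc ha hb ht, force_arc ha hb ht,
        ← wave_eq_arc ha hb ht, wave_turn ha hb]
      exact neg_ne_zero.2 (mul_ne_zero (pow_ne_zero _ hs.ne') (mul_ne_zero (pow_ne_zero _ hc)
        (div_ne_zero (pow_ne_zero _ (by norm_num)) hc)))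
    · rw [← encard_zeros ha hb hs hθ hr]
      congr 1
      ext x
      simp only [mem_ofPred_eq]
      refine and_congr_right fun h => ?_
      rw [hd1 x (Ioo_subset_I h)]
      simp [hs.ne']
    · intro x hx y hy hxy hx0 hy0 _
      obtain ⟨i, hi⟩ := hcrit x hx hx0
      obtain ⟨j, hj⟩ := hcrit y hy hy0
      have hij : i + 1 ≤ j := by
        have : turn P.a P.b i < turn P.a P.b j := by
          rw [← hi, ← hj]
          have := mul_lt_mul_of_pos_left hxy hs
          linarith
        exact (turn_strictMono ha hb).lt_iff_lt.1 this
      have h1 := turn_lt_node_succ ha hb i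
      have h2 := (node_lt_turn ha hb (i + 1)).trans_le ((turn_strictMono ha hb).monotone hij)
      have e : θ + s * (1 + ((node P.a P.b (i + 1) - θ) / s - 1)) = node P.a P.b (i + 1) := by
        field_simp; ring
      refine ⟨(node P.a P.b (i + 1) - θ) / s - 1, ⟨?_, ?_⟩, ?_⟩
      · rw [lt_sub_iff_add_lt, lt_div_iff₀ hs]; linarith
      · rw [sub_lt_iff_lt_add, div_lt_iff₀ hs]; linarith
      · simp only [e]; exact wave_node_succ ha hb i

/-! ### The symmetry that exchanges the two signs -/

/-- The parameters with `a` and `b` exchanged; this corresponds to replacing `u` by `-u`. -/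
def swapCoeff (P : Params mm mp) : Params mm mp := (P.2.1, P.1, P.2.2)

theorem swapCoeff_mem (hP : P ∈ Admissible mm mp) : swapCoeff P ∈ Admissible mm mp :=
  ⟨hP.2.1, hP.1, hP.2.2⟩

theorem d1_neg (u : ℝ → ℝ) : d1 (fun x => -u x) = fun x => -d1 u x := by
  ext x; exact derivWithin.fun_neg

theorem d2_neg (u : ℝ → ℝ) : d2 (fun x => -u x) = fun x => -d2 u x := by
  ext x; rw [d2, d1_neg]; exact derivWithin.fun_neg

theorem neg_mem_X_swapCoeff (h : u ∈ X P) : (fun x => -u x) ∈ X (swapCoeff P) := by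
  refine ⟨h.1.neg, ?_, ?_⟩
  · simp only [mul_neg, Finset.sum_neg_distrib, h.2.1]; rfl
  · simp only [mul_neg, Finset.sum_neg_distrib, h.2.2]; rfl

theorem IsHalfEigenvalueOf.swapCoeff {ν : ℤˣ} (h : IsHalfEigenvalueOf k ν P lam) :
    IsHalfEigenvalueOf k (-ν) (swapCoeff P) lam := by
  obtain ⟨u, ⟨hX, ⟨x₀, hx₀, hne⟩, hode⟩, -, ⟨hl, hr, hν⟩, ⟨hs, hc⟩, hz⟩ := h
  refine ⟨fun x => -u x, ⟨neg_mem_X_swapCoeff hX, ⟨x₀, hx₀, neg_ne_zero.2 hne⟩, fun x hx => ?_⟩,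
    neg_mem_X_swapCoeff hX, ?_, ⟨?_, ?_⟩, ?_⟩
  · have := hode x hx
    simp only [d2_neg, neg_neg]
    change d2 u x = lam * (P.b * max (-u x) 0 - P.a * max (u x) 0)
    linarith
  · simp only [d1_neg]
    exact ⟨neg_ne_zero.2 hl, neg_ne_zero.2 hr, by push_cast; linarith⟩
  · intro x hx h
    simp only [d1_neg, d2_neg, neg_eq_zero, ne_eq] at h ⊢
    exact hs x hx h
  · simpa only [d1_neg, neg_eq_zero] using hc
  · simpa only [d1_neg, neg_eq_zero, ne_eq] using hz

theorem isHalfEigenvalueOf_neg_one_iff :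
    IsHalfEigenvalueOf k (-1) P lam ↔ IsHalfEigenvalueOf k 1 (swapCoeff P) lam :=
  ⟨fun h => by simpa using h.swapCoeff, fun h => h.swapCoeff⟩

/-! ### Existence, uniqueness and smoothness -/

theorem existsUnique_halfEigenvalue_one (hP : P ∈ Admissible mm mp) (hk : 1 ≤ k) :
    ∃! lam, IsHalfEigenvalueOf k 1 P lam := by
  obtain ⟨s, ⟨θ, h⟩, huniq⟩ := existsUnique_shooting hP hk
  refine ⟨s ^ 2, (isHalfEigenvalueOf_one_iff hP).2 ⟨s, θ, rfl, h⟩, fun lam hlam => ?_⟩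
  obtain ⟨σ, θ', rfl, h'⟩ := (isHalfEigenvalueOf_one_iff hP).1 hlam
  rw [huniq σ ⟨θ', h'⟩]

theorem halfEigenvalue_one_eq (hP : P ∈ Admissible mm mp) (hk : 1 ≤ k) {s θ : ℝ}
    (h : Shooting P k s θ) : halfEigenvalue k 1 P = s ^ 2 :=
  (existsUnique_halfEigenvalue_one hP hk).unique
    (Classical.epsilon_spec (existsUnique_halfEigenvalue_one hP hk).exists)
    ((isHalfEigenvalueOf_one_iff hP).2 ⟨s, θ, rfl, h⟩)

theorem contDiffOn_halfEigenvalue_one (hk : 1 ≤ k) :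
    ContDiffOn ℝ 1 (fun P : Params mm mp => halfEigenvalue k 1 P) (Admissible mm mp) := by
  intro P hP
  obtain ⟨s, ⟨θ, h⟩, -⟩ := existsUnique_shooting hP hk
  obtain ⟨σ, hσ, hev⟩ := exists_local_shooting hP h
  have heq : ∀ Q ∈ Admissible mm mp, (∃ θ, Shooting Q k (σ Q) θ) →
      halfEigenvalue k 1 Q = σ Q ^ 2 := fun Q hQ ⟨_, h⟩ => halfEigenvalue_one_eq hQ hk h
  refine (hσ.pow 2).contDiffWithinAt.congr_of_eventuallyEq ?_ (heq P hP hev.self_of_nhds)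
  filter_upwards [self_mem_nhdsWithin, nhdsWithin_le_nhds hev] with Q hQ h using heq Q hQ h

theorem halfEigenvalue_neg_one : halfEigenvalue k (-1) P = halfEigenvalue k 1 (swapCoeff P) := by
  unfold halfEigenvalue
  congr 1
  ext lam
  exact isHalfEigenvalueOf_neg_one_iff

end equation

end MultiPoint

theorem mainTheorem3 (mm mp : ℕ) (hmm : 1 ≤ mm) (hmp : 1 ≤ mp) (k : ℕ) (hk : 1 ≤ k) (ν : ℤˣ) :
    (∀ P ∈ MultiPoint.Admissible mm mp, ∃! lam : ℝ, MultiPoint.IsHalfEigenvalueOf k ν P lam) ∧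
    ContDiffOn ℝ 1 (fun P : MultiPoint.Params mm mp => MultiPoint.halfEigenvalue k ν P)
      (MultiPoint.Admissible mm mp) := by
  rcases Int.units_eq_one_or ν with rfl | rfl
  · exact ⟨fun P hP => MultiPoint.existsUnique_halfEigenvalue_one hP hk,
      MultiPoint.contDiffOn_halfEigenvalue_one hk⟩
  · refine ⟨fun P hP => ?_, ?_⟩
    · simp only [MultiPoint.isHalfEigenvalueOf_neg_one_iff]
      exact MultiPoint.existsUnique_halfEigenvalue_one (MultiPoint.swapCoeff_mem hP) hk
    · simp only [MultiPoint.halfEigenvalue_neg_one]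
      refine (MultiPoint.contDiffOn_halfEigenvalue_one hk).comp (f := MultiPoint.swapCoeff) ?_
        fun P hP => MultiPoint.swapCoeff_mem hP
      unfold MultiPoint.swapCoeff
      fun_prop
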